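/- Consider the open, non-preemptive online dial-a-ride problem on the real line with a single server of capacity $c\in\{1,2,3,\dots\}\cup\{\infty\}$. A request sequence is $\sigma=(r_1,\dots,r_n)$, $n\ge 1$, with requests $r_i=(a_i,b_i;t_i)$, $a_i,b_i\in\mathbb{R}$ and $0<t_1<\dots<t_n$; request $r_i$ becomes known at time $t_i$, has to be loaded at $a_i$ at some time not earlier than $t_i$, and has to be transported to $b_i$ and unloaded there (and nowhere else). The server starts at time $0$ in the origin $0$, moves with at most unit speed, and carries at most $c$ requests at a time. Let $\mathrm{Opt}(\sigma)$ be the minimum time by which all requests of $\sigma$ can be served if $\sigma$ is known in advance, and let $\mathrm{Opt}(t)$ be the same quantity for the requests released not later than time $t$. For $\alpha\ge 0$, the algorithm $\mathrm{Lazy}(\alpha)$ works as follows. (i) Whenever a request is released, at time $t$ say, and the server is able to deliver all currently loaded requests and return to the origin by time $\alpha\cdot\mathrm{Opt}(t)$, it aborts what it is doing, delivers all loaded requests and returns to the origin in an optimal (shortest) way, and then is idle; otherwise it continues with its current activity. (ii) Whenever the server is idle at time $t$: if $t<\alpha\cdot\mathrm{Opt}(t)$, it waits at its current position until time $\alpha\cdot\mathrm{Opt}(t)$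 and then is idle again; otherwise, if the set $R_t$ of released but unserved requests is nonempty, it follows a shortest schedule that starts in its current position and serves all requests of $R_t$, and then is idle again. A request released at time $t$ is received before the server makes any decision at time $t$; ties between shortest schedules (or between optimal returns) are broken by an arbitrary fixed deterministic rule that depends only on what is known at that time. Let $\mathrm{Lazy}(\alpha)(\sigma)$ be the time by which all requests of $\sigma$ have been served. The competitive ratio of $\mathrm{Lazy}(\alpha)$ on the line is $\sup_\sigma \mathrm{Lazy}(\alpha)(\sigma)/\mathrm{Opt}(\sigma)$. Let $\varphi=\frac{1+\sqrt5}{2}$. For every $\alpha\ge 0$ with $\alpha\notin(2\varphi/3,\varphi)$, every capacity $c\in\{1,2,3,\dots\}\cup\{\infty\}$ and every tie-breaking rule, the competitive ratio of $\mathrm{Lazy}(\alpha)$ on the line is at least $1+\varphi$. -/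

import Mathlib

namespace DialARide

/-- A transportation request `(a, b; t)` on the real line: it appears at position `a` at its
release time `t` and has to be transported to position `b`. -/
@[ext]
structure Request where
  a : ℝ
  b : ℝ
  t : ℝ

noncomputable instance : DecidableEq Request := Classical.decEq _

/-- A request sequence: release times are positive and strictly increasing. -/
def IsRequestSequence (σ : List Request) : Prop :=
  (∀ r ∈ σ, 0 < r.t) ∧ σ.Pairwise (fun r r' => r.t < r'.t)

/-- The server loads a request at its starting position or unloads it at its destination. -/
inductive Action where
  | load (r : Request)
  | unload (r : Request)

/-- The position where an action takes place. -/
def Action.loc : Action → ℝ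
  | .load r => r.a
  | .unload r => r.b

/-- `Serves c L U S`: a server of capacity `c` that currently carries the requests in `L` can
perform the actions `S` in this order, and by doing so it delivers all requests in `L` and picks
up and delivers all requests in `U` (and no others).  Unloading is possible only at the
destination (no preemption). -/
def Serves (c : ℕ∞) : Finset Request → Finset Request → List Action → Prop
  | L, U, [] => L = ∅ ∧ U = ∅
  | L, U, .load r :: S =>
      r ∈ U ∧ (L.card : ℕ∞) + 1 ≤ c ∧ Serves c (insert r L) (U.erase r) S
  | L, U, .unload r :: S => r ∈ L ∧ Serves c (L.erase r) U S

/-! ### The offline optimum -/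

/-- `Timely x t S`: a server of unit speed that is at position `x` at time `t` can perform the
listed actions at the listed times (waiting where necessary), and no request is loaded before its
release time. -/
def Timely : ℝ → ℝ → List (ℝ × Action) → Prop
  | _, _, [] => True
  | x, t, (τ, A) :: S =>
      t + |A.loc - x| ≤ τ ∧ (∀ r, A = .load r → r.t ≤ τ) ∧ Timely A.loc τ S

/-- The time of the last action of a timed schedule (`t` if there is none). -/
def completion : ℝ → List (ℝ × Action) → ℝ
  | t, [] => t
  | _, (τ, _) :: S => completion τ S

/-- The offline optimum completion time for the set `R` of requests, for a server that starts at
time `0` in the origin `0` and knows all of `R` in advance. -/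
noncomputable def opt (c : ℕ∞) (R : Finset Request) : ℝ :=
  sInf {T | ∃ S : List (ℝ × Action),
    Serves c ∅ R (S.map Prod.snd) ∧ Timely 0 0 S ∧ completion 0 S = T}

/-! ### Shortest schedules, ignoring release times -/

/-- The distance walked when performing the actions `S` without detours, starting from `x`. -/
def walkLength : ℝ → List Action → ℝ
  | _, [] => 0
  | x, A :: S => |A.loc - x| + walkLength A.loc S

/-- The final position when performing the actions `S`, starting from `x`. -/
def endPos : ℝ → List Action → ℝ
  | x, [] => x
  | _, A :: S => endPos A.loc S

/-- The distance walked when performing the actions `S`, starting from `x`, and then returning to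
the origin. -/
def returnLength (x : ℝ) (S : List Action) : ℝ :=
  walkLength x S + |endPos x S|

/-- `S` is a shortest schedule serving all requests in `R` when starting (empty) from `x`. -/
def IsShortestSchedule (c : ℕ∞) (R : Finset Request) (x : ℝ) (S : List Action) : Prop :=
  Serves c ∅ R S ∧ ∀ S', Serves c ∅ R S' → walkLength x S ≤ walkLength x S'

/-- Starting from `x`, performing `S` and then returning to the origin is an optimal way of
delivering all loaded requests `L` and returning to the origin. -/
def IsOptimalReturn (c : ℕ∞) (L : Finset Request) (x : ℝ) (S : List Action) : Prop :=
  Serves c L ∅ S ∧ ∀ S', Serves c L ∅ S' → returnLength x S ≤ returnLength x S'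

/-- Shortest schedules need not be unique.  This is a deterministic rule selecting, from the set
`H` of requests released so far and the current time `t`, a shortest schedule `S(R, x)` for the
unserved requests `R` from the position `x`, and an optimal way to deliver the loaded requests `L`
and return to the origin from the position `x`. -/
structure TieBreaking (c : ℕ∞) where
  sched : (H : Finset Request) → (t : ℝ) → (R : Finset Request) → (x : ℝ) → List Action
  sched_spec : ∀ H t R x, IsShortestSchedule c R x (sched H t R x)
  ret : (H : Finset Request) → (t : ℝ) → (L : Finset Request) → (x : ℝ) → List Action
  ret_spec : ∀ H t L x, IsOptimalReturn c L x (ret H t L x)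

/-! ### The algorithm `Lazy(α)` as an event-driven simulation -/

/-- What the server is currently doing; lists contain the actions that are still to be done. -/
inductive Command where
  | idle
  | waitUntil (τ : ℝ)
  | followSchedule (S : List Action)
  | deliverAndReturn (S : List Action)

/-- A configuration of the system. -/
structure State where
  /-- the current time -/
  time : ℝ
  /-- the current position of the server -/
  pos : ℝ
  /-- requests currently carried by the server -/
  loaded : Finset Request
  /-- released requests that have not been loaded yet -/
  pending : Finset Request
  /-- all requests released so far -/
  released : Finset Request
  /-- requests that are still to be released -/
  future : List Request
  /-- the current command -/
  cmd : Command

/-- At the beginning, the server is idle in the origin. -/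
def State.init (σ : List Request) : State where
  time := 0
  pos := 0
  loaded := ∅
  pending := ∅
  released := ∅
  future := σ
  cmd := .idle

/-- The point that a server in position `x` is currently moving to. -/
def Command.heading (x : ℝ) : Command → ℝ
  | .idle => x
  | .waitUntil _ => x
  | .followSchedule [] => x
  | .followSchedule (A :: _) => A.loc
  | .deliverAndReturn [] => 0
  | .deliverAndReturn (A :: _) => A.loc

/-- The position after moving from `x` in the direction of `y` for `d` time units, stopping
at `y`. -/
noncomputable def moveToward (x y d : ℝ) : ℝ := x + max (-d) (min d (y - x))

/-- The server arrives at the location of the action `A`, performs it, and then continues with the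
command `next`. -/
noncomputable def State.perform (s : State) (A : Action) (next : Command) : State :=
  { s with
    time := s.time + |A.loc - s.pos|
    pos := A.loc
    loaded := match A with
      | .load r => insert r s.loaded
      | .unload r => s.loaded.erase r
    pending := match A with
      | .load r => s.pending.erase r
      | .unload _ => s.pending
    cmd := next }

/-- The time of the next event caused by the server itself, if no request is released before;
`⊤` if the server is idle and has nothing to do. -/
noncomputable def State.nextEvent (c : ℕ∞) (α : ℝ) (s : State) : WithTop ℝ :=
  match s.cmd with
  | .idle => if s.time < α * opt c s.released ∨ s.pending.Nonempty then s.time else ⊤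
  | .waitUntil τ => τ
  | .followSchedule S =>
      ((s.time + |(Command.followSchedule S).heading s.pos - s.pos| : ℝ) : WithTop ℝ)
  | .deliverAndReturn S =>
      ((s.time + |(Command.deliverAndReturn S).heading s.pos - s.pos| : ℝ) : WithTop ℝ)

/-- The next event caused by the server itself.  An idle server waits until time `α * Opt(t)`;
if this time has passed, it starts a shortest schedule for the unserved requests, if there are
any.  (The server carries nothing when it is idle, so the unserved requests are the pending
ones.) -/
noncomputable def State.act {c : ℕ∞} (α : ℝ) (B : TieBreaking c) (s : State) : State :=
  match s.cmd with
  | .idle =>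
      if s.time < α * opt c s.released then
        { s with cmd := .waitUntil (α * opt c s.released) }
      else if s.pending.Nonempty then
        { s with cmd := .followSchedule (B.sched s.released s.time s.pending s.pos) }
      else s
  | .waitUntil τ => { s with time := τ, cmd := .idle }
  | .followSchedule [] => { s with cmd := .idle }
  | .followSchedule (A :: S) => s.perform A (.followSchedule S)
  | .deliverAndReturn [] => { s with time := s.time + |s.pos|, pos := 0, cmd := .idle }
  | .deliverAndReturn (A :: S) => s.perform A (.deliverAndReturn S)

/-- The server proceeds with its current command until the release time of `r`, at which `r`
becomes known. -/
noncomputable def State.release (s : State) (r : Request) (fut : List Request) : State :=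
  { s with
    time := r.t
    pos := moveToward s.pos (s.cmd.heading s.pos) (r.t - s.time)
    pending := insert r s.pending
    released := insert r s.released
    future := fut }

/-- Reaction to a new request: if the server can deliver all loaded requests and return to the
origin until time `α * Opt(t)`, it does so, aborting its current command. -/
noncomputable def State.react {c : ℕ∞} (α : ℝ) (B : TieBreaking c) (s : State) : State :=
  let S := B.ret s.released s.time s.loaded s.pos
  if s.time + returnLength s.pos S ≤ α * opt c s.released then
    { s with cmd := .deliverAndReturn S }
  else s

/-- One step of `Lazy(α)`: the next release of a request or the next event of the server is
processed, whichever comes first; releases have priority. -/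
noncomputable def State.step {c : ℕ∞} (α : ℝ) (B : TieBreaking c) (s : State) : State :=
  match s.future with
  | [] => s.act α B
  | r :: fut =>
      if (r.t : WithTop ℝ) ≤ s.nextEvent c α then (s.release r fut).react α B
      else s.act α B

/-- All requests have been released and served. -/
def State.Completed (s : State) : Prop :=
  s.future = [] ∧ s.pending = ∅ ∧ s.loaded = ∅

/-- The completion time of `Lazy(α)` on the request sequence `σ`
(`∞` if not all requests are ever served). -/
noncomputable def lazyTime {c : ℕ∞} (α : ℝ) (B : TieBreaking c) (σ : List Request) : ENNReal :=
  ⨅ (n : ℕ) (_ : ((State.step α B)^[n] (State.init σ)).Completed),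
    ENNReal.ofReal ((State.step α B)^[n] (State.init σ)).time

/-- The strict competitive ratio `sup_σ Lazy(α)(σ) / Opt(σ)` on the line, over all (nonempty)
request sequences. -/
noncomputable def competitiveRatio {c : ℕ∞} (α : ℝ) (B : TieBreaking c) : ENNReal :=
  ⨆ (σ : List Request) (_ : IsRequestSequence σ) (_ : σ ≠ []),
    lazyTime α B σ / ENNReal.ofReal (opt c σ.toFinset)

/-! ### Tie-breaking rules exist -/

theorem finite_serves (c : ℕ∞) (n : ℕ) : ∀ L U : Finset Request, L.card + 2 * U.card ≤ n →
    {S | Serves c L U S}.Finite := by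
  induction n with
  | zero =>
    intro L U h
    have hL : L = ∅ := Finset.card_eq_zero.1 (by omega)
    have hU : U = ∅ := Finset.card_eq_zero.1 (by omega)
    subst hL hU
    refine (Set.finite_singleton []).subset ?_
    rintro (_ | ⟨_ | _, S⟩) h <;> simp_all [Serves]
  | succ n ih =>
    intro L U h
    have h1 : (⋃ r ∈ U, (fun S => Action.load r :: S) ''
        {S | Serves c (insert r L) (U.erase r) S}).Finite := by
      refine U.finite_toSet.biUnion fun r hr => (ih _ _ ?_).image _
      have := Finset.card_insert_le r L
      have := Finset.card_erase_add_one (Finset.mem_coe.1 hr)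
      omega
    have h2 : (⋃ r ∈ L, (fun S => Action.unload r :: S) ''
        {S | Serves c (L.erase r) U S}).Finite := by
      refine L.finite_toSet.biUnion fun r hr => (ih _ _ ?_).image _
      have := Finset.card_erase_add_one (Finset.mem_coe.1 hr)
      omega
    refine (((Set.finite_singleton []).union h1).union h2).subset ?_
    rintro (_ | ⟨r | r, S⟩) hS
    · simp
    · left; right
      simp only [Set.mem_iUnion]
      exact ⟨r, hS.1, S, hS.2.2, rfl⟩
    · right
      simp only [Set.mem_iUnion]
      exact ⟨r, hS.1, S, hS.2, rfl⟩

theorem exists_serves {c : ℕ∞} (hc : 1 ≤ c) (R : Finset Request) : ∃ S, Serves c ∅ R S := by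
  induction R using Finset.induction_on with
  | empty => exact ⟨[], rfl, rfl⟩
  | insert r R hr ih =>
    obtain ⟨S, hS⟩ := ih
    refine ⟨.load r :: .unload r :: S, by simp, by simpa using hc, by simp, ?_⟩
    simpa [Finset.erase_insert hr] using hS

theorem exists_serves_loaded (c : ℕ∞) (L : Finset Request) : ∃ S, Serves c L ∅ S := by
  induction L using Finset.induction_on with
  | empty => exact ⟨[], rfl, rfl⟩
  | insert r L hr ih =>
    obtain ⟨S, hS⟩ := ih
    refine ⟨.unload r :: S, by simp, ?_⟩
    simpa [Finset.erase_insert hr] using hS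

/-- Shortest schedules and optimal returns always exist. -/
theorem TieBreaking.nonempty {c : ℕ∞} (hc : 1 ≤ c) : Nonempty (TieBreaking c) := by
  have h1 : ∀ R x, ∃ S, IsShortestSchedule c R x S := fun R x =>
    (Set.exists_min_image _ (walkLength x) (finite_serves c _ ∅ R le_rfl) (exists_serves hc R))
  have h2 : ∀ L x, ∃ S, IsOptimalReturn c L x S := fun L x =>
    (Set.exists_min_image _ (returnLength x) (finite_serves c _ L ∅ le_rfl)
      (exists_serves_loaded c L))
  choose f hf using h1
  choose g hg using h2
  exact ⟨⟨fun _ _ => f, fun _ _ => hf, fun _ _ => g, fun _ _ => hg⟩⟩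

end DialARide

/-!
All lower bounds rest on two observations. While the server waits in the origin, every request
released before time `α * Opt` only makes it wait longer, so the first batch of requests is served
from the origin from time `α * Opt` on. And once the server has loaded a request whose destination
is far away (or is itself far away), it can no longer deliver what it carries and be back in the
origin by time `α * Opt`; it has to complete its schedule, and requests released in the meantime
have to wait. An adversary can therefore release requests right after the server has committed
itself. With release times that are multiples of a small `ε → 0`, this gives

* for `α = 0`, the ratio `3`: a second request appears in the origin after the server has left;
* for `0 < α`, the ratio `1 + α`: a single request to `1` is delivered at time `1 + α`;
* for `0 < α < 1`, the ratio `1 + 3 / (α + 1)`: the server is sent to `1`, back to `0`, and again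
  to `1`, while the optimum waits and serves everything on a single way from `0` to `1`;
* for `5 / 7 < α ≤ 1`, the ratio `(7 + α) / 3`, and for `1 ≤ α` with `3 * α ^ 2 < 3 * α + 2`, the
  ratio `2 + 2 / (3 * α)`: the server is made to visit first the left and then the right end of an
  interval, and the last request appears on the left, while the optimum goes right first.

Since `φ ^ 2 = φ + 1`, one of these ratios is at least `1 + φ` for each `α` outside
`(2 * φ / 3, φ)`.
-/

namespace DialARide

open Filter Topology

variable {c : ℕ∞} {α : ℝ} {B : TieBreaking c} {s : State} {S l : List Action}
  {L U V H R : Finset Request} {r : Request} {rs σ fut late : List Request}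
  {t τ p x F e K X ε b u v q y z : ℝ}

/-! ### Schedules -/

theorem exists_append_cons_sublist {β : Type*} {l S : List β} {a : β} (h : l.Sublist S)
    (ha : a ∈ S) (hl : a ∉ l) : ∃ l₁ l₂, l = l₁ ++ l₂ ∧ (l₁ ++ a :: l₂).Sublist S := by
  induction h with
  | slnil => simp at ha
  | @cons l S b h ih =>
    rcases List.mem_cons.1 ha with rfl | ha
    · exact ⟨[], l, rfl, h.cons_cons a⟩
    · obtain ⟨l₁, l₂, rfl, h'⟩ := ih ha hl
      exact ⟨l₁, l₂, rfl, h'.cons b⟩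
  | @cons_cons l S b h ih =>
    rw [List.mem_cons, not_or] at hl
    obtain ⟨l₁, l₂, rfl, h'⟩ := ih ((List.mem_cons.1 ha).resolve_left hl.1) hl.2
    exact ⟨b :: l₁, l₂, rfl, h'.cons_cons b⟩

theorem insert_pair_sublist {β : Type*} {S : List β} {a b d : β} (h : [b, d].Sublist S)
    (ha : a ∈ S) (hb : a ≠ b) (hd : a ≠ d) :
    [a, b, d].Sublist S ∨ [b, a, d].Sublist S ∨ [b, d, a].Sublist S := by
  obtain ⟨l₁, l₂, hl, h'⟩ := exists_append_cons_sublist h ha (by simp [hb, hd])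
  rcases l₁ with _ | ⟨_, _ | ⟨_, _ | _⟩⟩ <;> simp_all

theorem walkLength_nonneg (x : ℝ) (S : List Action) : 0 ≤ walkLength x S := by
  induction S generalizing x with
  | nil => exact le_rfl
  | cons A S ih => exact add_nonneg (abs_nonneg _) (ih _)

theorem walkLength_add_abs_endPos_sub_le_of_sublist (h : l.Sublist S) (x : ℝ) :
    walkLength x l + |endPos x S - endPos x l| ≤ walkLength x S := by
  induction h generalizing x with
  | slnil => simp [walkLength, endPos]
  | @cons l S A h ih =>
    have ih := ih A.loc
    cases l with
    | nil =>
      simp only [walkLength, endPos] at ih ⊢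
      linarith [abs_sub_le (endPos A.loc S) A.loc x]
    | cons A' l =>
      simp only [walkLength, endPos] at ih ⊢
      linarith [abs_sub_le A'.loc A.loc x]
  | cons_cons A _ ih =>
    have ih := ih A.loc
    simp only [walkLength, endPos] at ih ⊢
    linarith

theorem walkLength_le_of_sublist (h : l.Sublist S) (x : ℝ) : walkLength x l ≤ walkLength x S :=
  (le_add_of_nonneg_right (abs_nonneg _)).trans (walkLength_add_abs_endPos_sub_le_of_sublist h x)

theorem endPos_eq_of_sublist (h : l.Sublist S) (hle : walkLength x S ≤ walkLength x l) :
    endPos x S = endPos x l := by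
  have := walkLength_add_abs_endPos_sub_le_of_sublist h x
  rw [← sub_eq_zero, ← abs_nonpos_iff]
  linarith

theorem Serves.eq_nil (h : Serves c ∅ ∅ S) : S = [] := by
  rcases S with _ | ⟨_ | _, S⟩ <;> simp_all [Serves]

theorem Serves.unload_mem (h : Serves c L U S) (hr : r ∈ L) : .unload r ∈ S := by
  induction S generalizing L U with
  | nil => simp [h.1] at hr
  | cons A S ih =>
    cases A with
    | load r' => exact List.mem_cons_of_mem _ (ih h.2.2 (by simp [hr]))
    | unload r' =>
      by_cases hr' : r = r'
      · simp [hr']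
      · exact List.mem_cons_of_mem _ (ih h.2 (by simp [hr, hr']))

theorem Serves.load_unload_sublist (h : Serves c L U S) (hr : r ∈ U) :
    [.load r, .unload r].Sublist S := by
  induction S generalizing L U with
  | nil => simp [h.2] at hr
  | cons A S ih =>
    cases A with
    | load r' =>
      by_cases hr' : r = r'
      · subst hr'
        exact (List.singleton_sublist.2 (h.2.2.unload_mem (by simp))).cons_cons _
      · exact (ih h.2.2 (by simp [hr, hr'])).cons _
    | unload r' => exact (ih h.2 hr).cons _

theorem Serves.exists_load_cons (h : Serves c ∅ U S) (hU : U.Nonempty) :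
    ∃ r ∈ U, ∃ S', S = .load r :: S' ∧ Serves c {r} (U.erase r) S' := by
  rcases S with _ | ⟨r | r, S⟩
  · exact absurd h.2 hU.ne_empty
  · exact ⟨r, h.1, S, rfl, h.2.2⟩
  · exact absurd h.1 (by simp)

theorem Serves.abs_add_abs_le_walkLength (h : Serves c ∅ R S) (hr : r ∈ R) (x : ℝ) :
    |r.a - x| + |r.b - r.a| ≤ walkLength x S := by
  simpa [walkLength, Action.loc] using walkLength_le_of_sublist (h.load_unload_sublist hr) x

theorem Serves.load_unload_cons (hc : 1 ≤ c) (hr : r ∉ U) (h : Serves c ∅ U S) :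
    Serves c ∅ (insert r U) (.load r :: .unload r :: S) := by
  refine ⟨by simp, by simpa using hc, by simp, ?_⟩
  simpa [Finset.erase_insert hr] using h

/-- The schedule that serves the requests one after the other, in the given order. -/
def serial (rs : List Request) : List Action :=
  rs.flatMap fun r => [.load r, .unload r]

theorem walkLength_serial_nil (x : ℝ) : walkLength x (serial []) = 0 := rfl

theorem walkLength_serial_cons (x : ℝ) (r : Request) (rs : List Request) :
    walkLength x (serial (r :: rs)) =
      |r.a - x| + |r.b - r.a| + walkLength r.b (serial rs) :=
  (add_assoc _ _ _).symm

theorem serves_serial (hc : 1 ≤ c) (hn : rs.Nodup) (hR : rs.toFinset = R) :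
    Serves c ∅ R (serial rs) := by
  subst hR
  induction rs with
  | nil => exact ⟨rfl, rfl⟩
  | cons r rs ih =>
    rw [List.nodup_cons] at hn
    rw [List.toFinset_cons]
    exact (ih hn.2).load_unload_cons hc (by simpa using hn.1)

theorem Serves.exists_eq_serial (h : Serves 1 ∅ U S) :
    ∃ rs : List Request, rs.Nodup ∧ rs.toFinset = U ∧ S = serial rs := by
  induction U using Finset.strongInduction generalizing S with
  | H U ih =>
    rcases U.eq_empty_or_nonempty with rfl | hU
    · exact ⟨[], by simp, rfl, h.eq_nil⟩
    obtain ⟨r, hr, S, rfl, hS⟩ := h.exists_load_cons hU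
    rcases S with _ | ⟨q | q, S⟩
    · simp [Serves] at hS
    · exact absurd hS.2.1 (by simp only [Finset.card_singleton, Nat.cast_one]; decide)
    obtain rfl : q = r := Finset.mem_singleton.1 hS.1
    obtain ⟨rs, hn, hrs, rfl⟩ := ih _ (Finset.erase_ssubset hr) (by simpa using hS.2)
    refine ⟨q :: rs, List.nodup_cons.2 ⟨fun hq => ?_, hn⟩, ?_, rfl⟩
    · simpa [hrs] using List.mem_toFinset.2 hq
    · rw [List.toFinset_cons, hrs, Finset.insert_erase hr]

theorem serves_interleaved (hc : 2 ≤ c) {r r' : Request} (h : r ≠ r') :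
    Serves c ∅ {r, r'} [.load r, .load r', .unload r, .unload r'] := by
  have he : ({r, r'} : Finset Request).erase r = {r'} := Finset.erase_insert (by simpa using h)
  refine ⟨by simp, ?_, ?_, ?_, by simp, ?_, ?_, ?_⟩
  · simpa using (by norm_num : (1 : ℕ∞) ≤ 2).trans hc
  · rw [he]; simp
  · simpa [one_add_one_eq_two] using hc
  · simp [h.symm]
  · rw [insert_empty_eq, Finset.pair_comm, he]; simp
  · rw [he]; simp

theorem IsShortestSchedule.singleton (hc : 1 ≤ c) (h : IsShortestSchedule c {r} x S) :
    endPos x S = r.b ∧ walkLength x S = |r.a - x| + |r.b - r.a| := by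
  have hsub := h.1.load_unload_sublist (Finset.mem_singleton_self r)
  have hle := h.2 _ (serves_serial hc (List.nodup_singleton r) rfl)
  refine ⟨endPos_eq_of_sublist hsub hle, le_antisymm ?_ ?_⟩
  · simpa [serial, walkLength, Action.loc] using hle
  · exact h.1.abs_add_abs_le_walkLength (Finset.mem_singleton_self r) x

/-! ### The offline optimum -/

theorem add_abs_sub_le_iff {y : ℝ} :
    t + |y - x| ≤ τ ↔ t + (y - x) ≤ τ ∧ t + (x - y) ≤ τ := by
  rw [← le_sub_iff_add_le', abs_le', neg_sub, le_sub_iff_add_le', le_sub_iff_add_le']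

theorem timely_cons_load {S : List (ℝ × Action)} :
    Timely x t ((τ, .load r) :: S) ↔
      t + (r.a - x) ≤ τ ∧ t + (x - r.a) ≤ τ ∧ r.t ≤ τ ∧ Timely r.a τ S := by
  simp [Timely, Action.loc, add_abs_sub_le_iff, and_assoc]

theorem timely_cons_unload {S : List (ℝ × Action)} :
    Timely x t ((τ, .unload r) :: S) ↔
      t + (r.b - x) ≤ τ ∧ t + (x - r.b) ≤ τ ∧ Timely r.b τ S := by
  simp [Timely, Action.loc, add_abs_sub_le_iff, and_assoc]

theorem timely_nil : Timely x t [] := trivial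

theorem exists_timely (S : List Action) (x t : ℝ) :
    ∃ S' : List (ℝ × Action), S'.map Prod.snd = S ∧ Timely x t S' := by
  induction S generalizing x t with
  | nil => exact ⟨[], rfl, trivial⟩
  | cons A S ih =>
    obtain ⟨τ, hx, hr⟩ : ∃ τ, t + |A.loc - x| ≤ τ ∧ ∀ r, A = .load r → r.t ≤ τ := by
      cases A with
      | load r => exact ⟨max _ r.t, le_max_left _ _, fun _ h => by cases h; exact le_max_right _ _⟩
      | unload r => exact ⟨_, le_rfl, fun _ h => by cases h⟩
    obtain ⟨S', hS', h⟩ := ih A.loc τ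
    exact ⟨(τ, A) :: S', by simp [hS'], hx, hr, h⟩

theorem Timely.add_walkLength_le_completion {S : List (ℝ × Action)} (h : Timely x t S) :
    t + walkLength x (S.map Prod.snd) ≤ completion t S := by
  induction S generalizing x t with
  | nil => simp [walkLength, completion]
  | cons A S ih =>
    simp only [List.map_cons, walkLength, completion]
    linarith [ih h.2.2, h.1]

theorem Timely.of_earlier {S : List (ℝ × Action)} {x' t' : ℝ} (h : Timely x t S)
    (ht : t' + |x - x'| ≤ t) : Timely x' t' S := by
  cases S with
  | nil => trivial
  | cons A S => exact ⟨by linarith [h.1, abs_sub_le A.2.loc x x'], h.2.1, h.2.2⟩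

theorem Timely.sublist {l S : List (ℝ × Action)} (h : Timely x t S) (hl : l.Sublist S) :
    Timely x t l ∧ completion t l ≤ completion t S := by
  induction hl generalizing x t with
  | slnil => exact ⟨h, le_rfl⟩
  | @cons l S A _ ih =>
    obtain ⟨hl, hle⟩ := ih h.2.2
    refine ⟨hl.of_earlier h.1, le_trans ?_ hle⟩
    cases l with
    | nil => exact (le_add_of_nonneg_right (abs_nonneg _)).trans h.1
    | cons => exact le_rfl
  | cons_cons A _ ih => exact ⟨⟨h.1, h.2.1, (ih h.2.2).1⟩, (ih h.2.2).2⟩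

/-- The request that is loaded or unloaded by an action. -/
def Action.request : Action → Request
  | .load r => r
  | .unload r => r

theorem Serves.filter (p : Request → Prop) [DecidablePred p] (h : Serves c L U S) :
    Serves c (L.filter p) (U.filter p) (S.filter fun A => p A.request) := by
  induction S generalizing L U with
  | nil => simp [Serves, h.1, h.2]
  | cons A S ih =>
    cases A with
    | load r =>
      obtain ⟨hr, hcard, h⟩ := h
      have ih := ih h
      rw [Finset.filter_insert, Finset.filter_erase] at ih
      by_cases hp : p r
      · rw [if_pos hp] at ih
        rw [List.filter_cons_of_pos (by exact decide_eq_true hp)]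
        exact ⟨by simp [hr, hp], le_trans (by gcongr; exact L.filter_subset p) hcard, ih⟩
      · rw [if_neg hp, Finset.erase_eq_of_notMem (by simp [hp])] at ih
        rwa [List.filter_cons_of_neg (by exact mt of_decide_eq_true hp)]
    | unload r =>
      obtain ⟨hr, h⟩ := h
      have ih := ih h
      rw [Finset.filter_erase] at ih
      by_cases hp : p r
      · rw [List.filter_cons_of_pos (by exact decide_eq_true hp)]
        exact ⟨by simp [hr, hp], ih⟩
      · rw [Finset.erase_eq_of_notMem (by simp [hp])] at ih
        rwa [List.filter_cons_of_neg (by exact mt of_decide_eq_true hp)]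

theorem opt_le (S : List (ℝ × Action)) (h : Serves c ∅ R (S.map Prod.snd)) (ht : Timely 0 0 S) :
    opt c R ≤ completion 0 S := by
  refine csInf_le ⟨0, ?_⟩ ⟨S, h, ht, rfl⟩
  rintro _ ⟨S, -, ht, rfl⟩
  linarith [ht.add_walkLength_le_completion, walkLength_nonneg 0 (S.map Prod.snd)]

theorem le_opt_of_forall_timely (hc : 1 ≤ c) {m : ℝ}
    (h : ∀ S : List (ℝ × Action), Serves c ∅ R (S.map Prod.snd) → Timely 0 0 S →
      m ≤ completion 0 S) : m ≤ opt c R := by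
  obtain ⟨S, hS⟩ := exists_serves hc R
  obtain ⟨S', rfl, ht⟩ := exists_timely S 0 0
  refine le_csInf ⟨_, S', hS, ht, rfl⟩ ?_
  rintro _ ⟨S, hS, ht, rfl⟩
  exact h S hS ht

theorem le_opt (hc : 1 ≤ c) {m : ℝ} (h : ∀ S, Serves c ∅ R S → m ≤ walkLength 0 S) :
    m ≤ opt c R :=
  le_opt_of_forall_timely hc fun S hS ht => by
    linarith [h _ hS, ht.add_walkLength_le_completion]

theorem opt_mono (hc : 1 ≤ c) (h : R ⊆ U) : opt c R ≤ opt c U := by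
  refine le_opt_of_forall_timely hc fun S hS ht => ?_
  obtain ⟨ht', hle⟩ := ht.sublist (l := S.filter fun A => A.2.request ∈ R) List.filter_sublist
  refine (opt_le _ ?_ ht').trans hle
  convert hS.filter (· ∈ R) using 1
  · simp
  · ext r; simpa using @h r
  · rw [List.filter_map]; rfl

theorem opt_empty : opt c ∅ = 0 := by
  refine le_antisymm (opt_le [] ⟨rfl, rfl⟩ trivial) (le_csInf ⟨0, [], ⟨rfl, rfl⟩, trivial, rfl⟩ ?_)
  rintro _ ⟨S, -, ht, rfl⟩
  linarith [ht.add_walkLength_le_completion, walkLength_nonneg 0 (S.map Prod.snd)]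

theorem abs_b_le_opt (hc : 1 ≤ c) (hr : r ∈ R) : |r.b| ≤ opt c R := by
  refine le_opt hc fun S hS => ?_
  have := hS.abs_add_abs_le_walkLength hr 0
  rw [sub_zero] at this
  linarith [abs_sub_abs_le_abs_sub r.b r.a]

/-! ### Runs -/

/-- In the run of `Lazy(α)` from the state `s`, all requests are served only at time `X` or
later. -/
def CompletesAfter (α : ℝ) (B : TieBreaking c) (s : State) (X : ℝ) : Prop :=
  ∀ n, ((State.step α B)^[n] s).Completed → X ≤ ((State.step α B)^[n] s).time

theorem CompletesAfter.of_step (hs : s.Completed → X ≤ s.time)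
    (h : CompletesAfter α B (s.step α B) X) : CompletesAfter α B s X := by
  rintro (_ | n) hn
  · exact hs hn
  · rw [Function.iterate_succ_apply] at hn ⊢
    exact h n hn

theorem CompletesAfter.mono {Y : ℝ} (h : CompletesAfter α B s Y) (hX : X ≤ Y) :
    CompletesAfter α B s X :=
  fun n hn => hX.trans (h n hn)

theorem CompletesAfter.le_lazyTime {σ : List Request} (h : CompletesAfter α B (.init σ) X) :
    ENNReal.ofReal X ≤ lazyTime α B σ :=
  le_iInf₂ fun n hn => ENNReal.ofReal_le_ofReal (h n hn)

theorem State.not_completed_of_future (hf : s.future = r :: fut) : ¬ s.Completed :=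
  fun h => by simp [h.1] at hf

theorem State.not_completed_of_pending (h : s.pending.Nonempty) : ¬ s.Completed :=
  fun h' => h.ne_empty h'.2.1

theorem State.step_eq_act (h : ∀ r ∈ s.future.head?, s.nextEvent c α < (r.t : WithTop ℝ)) :
    s.step α B = s.act α B := by
  unfold State.step
  split
  case h_1 => rfl
  case h_2 r fut hr => rw [if_neg (not_le.2 (h r (by simp [hr])))]

theorem State.step_eq_release (hf : s.future = r :: fut)
    (h : (r.t : WithTop ℝ) ≤ s.nextEvent c α) : s.step α B = (s.release r fut).react α B := by
  unfold State.step
  rw [hf]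
  exact if_pos h

/-- The state at time `t` of an empty server that is idle in `p`, where the requests in `H` have
been released, those in `V` are unserved, and those in `fut` are still to come. -/
@[simps]
def State.idleAt (t p : ℝ) (V H : Finset Request) (fut : List Request) : State :=
  ⟨t, p, ∅, V, H, fut, .idle⟩

/-- Like `State.idleAt`, but the server has decided to wait in `p` until time `τ`. -/
@[simps]
def State.waitingAt (t τ p : ℝ) (V H : Finset Request) (fut : List Request) : State :=
  ⟨t, p, ∅, V, H, fut, .waitUntil τ⟩

theorem completesAfter_waitingAt (hX : V = ∅ → X ≤ t) (hf : ∀ r ∈ fut.head?, τ < r.t)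
    (h : CompletesAfter α B (.idleAt τ p V H fut) X) :
    CompletesAfter α B (.waitingAt t τ p V H fut) X := by
  refine .of_step (fun h => hX h.2.1) ?_
  rwa [State.step_eq_act fun r hr => by simpa [State.nextEvent] using hf r hr]

theorem completesAfter_idleAt_of_lt (hX : V = ∅ → X ≤ t) (ht : t < α * opt c H)
    (hf : ∀ r ∈ fut.head?, t < r.t)
    (h : CompletesAfter α B (.waitingAt t (α * opt c H) p V H fut) X) :
    CompletesAfter α B (.idleAt t p V H fut) X := by
  refine .of_step (fun h => hX h.2.1) ?_
  rw [State.step_eq_act fun r hr => by simpa [State.nextEvent, ht] using hf r hr]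
  simpa [State.act, ht, State.waitingAt] using h

theorem completesAfter_idleAt_of_max (hX : V = ∅ → X ≤ t)
    (hf : ∀ r ∈ fut.head?, max t (α * opt c H) < r.t)
    (h : CompletesAfter α B (.idleAt (max t (α * opt c H)) p V H fut) X) :
    CompletesAfter α B (.idleAt t p V H fut) X := by
  rcases le_or_gt (α * opt c H) t with ht | ht
  · rwa [max_eq_left ht] at h
  · rw [max_eq_right ht.le] at h hf
    exact completesAfter_idleAt_of_lt hX ht (fun r hr => ht.trans (hf r hr))
      (completesAfter_waitingAt hX hf h)

theorem completesAfter_idleAt_nil (hX : X ≤ t) :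
    CompletesAfter α B (.idleAt t p ∅ H []) X := by
  refine completesAfter_idleAt_of_max (fun _ => hX) (by simp) fun n _ => ?_
  rw [Function.iterate_fixed]
  · exact le_max_of_le_left hX
  · simp [State.step, State.act]

/-! ### Returns to the origin -/

theorem returnLength_cons (x : ℝ) (A : Action) (S : List Action) :
    returnLength x (A :: S) = |A.loc - x| + returnLength A.loc S :=
  add_assoc _ _ _

theorem abs_le_returnLength (S : List Action) (x : ℝ) : |x| ≤ returnLength x S := by
  induction S generalizing x with
  | nil => simp [returnLength, walkLength, endPos]
  | cons A S ih =>
    rw [returnLength_cons]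
    linarith [ih A.loc, abs_sub_abs_le_abs_sub x A.loc, abs_sub_comm x A.loc]

theorem returnLength_le_of_sublist {l : List Action} (h : l.Sublist S) (x : ℝ) :
    returnLength x l ≤ returnLength x S := by
  unfold returnLength
  linarith [walkLength_add_abs_endPos_sub_le_of_sublist h x,
    abs_sub_abs_le_abs_sub (endPos x l) (endPos x S), abs_sub_comm (endPos x l) (endPos x S)]

/-- The server cannot deliver what it carries and be back in the origin before time `K`,
neither now nor later: it is too far away, or one of the loaded requests is. -/
def Far (K : ℝ) (s : State) : Prop :=
  K ≤ s.time + |s.pos| ∨ ∃ r ∈ s.loaded, K ≤ s.time + |r.b - s.pos| + |r.b|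

theorem Far.le_returnLength (h : Far K s) (hS : Serves c s.loaded U S) :
    K ≤ s.time + returnLength s.pos S := by
  rcases h with h | ⟨r, hr, h⟩
  · linarith [abs_le_returnLength S s.pos]
  · have := returnLength_le_of_sublist (List.singleton_sublist.2 (hS.unload_mem hr)) s.pos
    simp only [returnLength, walkLength, endPos, Action.loc, add_zero] at this ⊢
    linarith

theorem Far.react (h : Far K s) (hK : α * opt c s.released < K) : s.react α B = s := by
  unfold State.react
  have := h.le_returnLength (B.ret_spec s.released s.time s.loaded s.pos).1
  exact if_neg (by linarith)

theorem Far.move {s' : State} (h : Far K s) (hl : s'.loaded = s.loaded)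
    (hd : |s'.pos - s.pos| ≤ s'.time - s.time) : Far K s' := by
  rcases h with h | ⟨r, hr, h⟩
  · left
    linarith [abs_sub_abs_le_abs_sub s.pos s'.pos, abs_sub_comm s.pos s'.pos]
  · right
    exact ⟨r, hl ▸ hr, by linarith [abs_sub_le r.b s'.pos s.pos]⟩

theorem Far.perform (h : Far K s) (A : Action) (C : Command) : Far K (s.perform A C) := by
  rcases h with h | ⟨r, hr, h⟩
  · left
    simp only [State.perform]
    linarith [abs_sub_abs_le_abs_sub s.pos A.loc, abs_sub_comm s.pos A.loc]
  by_cases hA : A = .unload r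
  · subst hA
    exact .inl h
  · refine .inr ⟨r, ?_, ?_⟩
    · cases A with
      | load r' => simp [State.perform, hr]
      | unload r' => simpa [State.perform, hr, eq_comm] using hA
    · simp only [State.perform]
      linarith [abs_sub_le r.b A.loc s.pos]

/-! ### Following a schedule -/

/-- In the state `s` the server follows the schedule `S`, which serves the pending requests `U`
but not the pending requests `V`; it will be done at time `F` in position `e`. -/
structure Following (c : ℕ∞) (s : State) (S : List Action) (U V : Finset Request) (F e : ℝ) :
    Prop where
  cmd : s.cmd = .followSchedule S
  serves : Serves c s.loaded U S
  pending : s.pending = U ∪ V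
  disjoint : Disjoint U V
  subset : U ⊆ s.released
  finish : s.time + walkLength s.pos S = F
  last : endPos s.pos S = e

theorem Following.perform {A : Action} (h : Following c s (A :: S) U V F e) :
    ∃ U', Following c (s.perform A (.followSchedule S)) S U' V F e := by
  have hF : s.time + |A.loc - s.pos| + walkLength A.loc S = F := by
    rw [add_assoc]; exact h.finish
  cases A with
  | load r =>
    obtain ⟨hr, -, hS⟩ := h.serves
    refine ⟨U.erase r, rfl, hS, ?_, h.disjoint.mono_left (U.erase_subset r),
      (U.erase_subset r).trans h.subset, hF, h.last⟩
    simp only [State.perform, h.pending]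
    rw [Finset.erase_union_distrib,
      Finset.erase_eq_of_notMem (Finset.disjoint_left.1 h.disjoint hr)]
  | unload r => exact ⟨U, rfl, h.serves.2, h.pending, h.disjoint, h.subset, hF, h.last⟩

theorem Following.act_cons {A : Action} (h : Following c s (A :: S) U V F e) :
    s.act α B = s.perform A (.followSchedule S) := by
  simp [State.act, h.cmd]

theorem Following.act_nil (h : Following c s [] U V F e) :
    s.act α B = .idleAt F e V s.released s.future := by
  obtain ⟨hcmd, ⟨hl, rfl⟩, hp, -, -, hF, he⟩ := h
  obtain ⟨⟩ := s
  simp only [walkLength, add_zero, endPos, Finset.empty_union] at *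
  simp [State.act, State.idleAt, *]

theorem Following.nextEvent_cons {A : Action} (h : Following c s (A :: S) U V F e) :
    s.nextEvent c α = ((s.time + |A.loc - s.pos| : ℝ) : WithTop ℝ) := by
  simp [State.nextEvent, h.cmd, Command.heading]

theorem Following.nextEvent_nil (h : Following c s [] U V F e) :
    s.nextEvent c α = (F : WithTop ℝ) := by
  simp [State.nextEvent, h.cmd, Command.heading, ← h.finish, walkLength]

theorem Following.eq_nil_of_completed (h : Following c s S U V F e) (hs : s.Completed) :
    S = [] ∧ V = ∅ := by
  obtain ⟨rfl, rfl⟩ := Finset.union_eq_empty.1 (h.pending.symm.trans hs.2.1)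
  exact ⟨(hs.2.2 ▸ h.serves).eq_nil, rfl⟩

theorem Following.completesAfter (h : Following c s S U V F e) (hV : V = ∅ → X ≤ F)
    (hf : ∀ r ∈ s.future.head?, F < r.t)
    (hX : CompletesAfter α B (.idleAt F e V s.released s.future) X) :
    CompletesAfter α B s X := by
  induction S generalizing s U with
  | nil =>
    have hF : s.time = F := by simpa [walkLength] using h.finish
    refine .of_step (fun hs => hF ▸ hV (h.eq_nil_of_completed hs).2) ?_
    rwa [State.step_eq_act fun r hr => by
      rw [h.nextEvent_nil]; exact_mod_cast hf r hr, h.act_nil]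
  | cons A S ih =>
    refine .of_step (fun hs => by simpa using (h.eq_nil_of_completed hs).1) ?_
    have hle : s.time + |A.loc - s.pos| ≤ F := by
      rw [← h.finish, walkLength]
      linarith [walkLength_nonneg A.loc S]
    rw [State.step_eq_act fun r hr => by
      rw [h.nextEvent_cons]; exact_mod_cast hle.trans_lt (hf r hr), h.act_cons]
    obtain ⟨U', hU'⟩ := h.perform
    exact ih hU' hf hX

theorem moveToward_spec {y d : ℝ} (h0 : 0 ≤ d) (h : d ≤ |y - x|) :
    |moveToward x y d - x| = d ∧ |y - moveToward x y d| = |y - x| - d := by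
  unfold moveToward
  rcases le_total 0 (y - x) with hy | hy
  · rw [abs_of_nonneg hy] at h ⊢
    rw [min_eq_left h, max_eq_right (by linarith), add_sub_cancel_left, abs_of_nonneg h0,
      abs_of_nonneg (by linarith)]
    exact ⟨rfl, by ring⟩
  · rw [abs_of_nonpos hy] at h ⊢
    rw [min_eq_right (by linarith), max_eq_left (by linarith), add_sub_cancel_left, abs_neg,
      abs_of_nonneg h0, abs_of_nonpos (by linarith)]
    exact ⟨rfl, by ring⟩

theorem Following.release {A : Action} (h : Following c s (A :: S) U V F e) (ht : s.time ≤ r.t)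
    (htA : r.t ≤ s.time + |A.loc - s.pos|) (hr : r ∉ s.released) :
    Following c (s.release r fut) (A :: S) U (insert r V) F e ∧
      |(s.release r fut).pos - s.pos| = r.t - s.time := by
  obtain ⟨hx, hA⟩ := moveToward_spec (sub_nonneg.2 ht) (sub_le_iff_le_add'.2 htA)
  have hpos : (s.release r fut).pos = moveToward s.pos A.loc (r.t - s.time) := by
    simp [State.release, h.cmd, Command.heading]
  refine ⟨⟨h.cmd, h.serves, ?_, ?_, h.subset.trans (Finset.subset_insert _ _), ?_, h.last⟩,
    hpos ▸ hx⟩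
  · simp [State.release, h.pending]
  · exact Finset.disjoint_insert_right.2 ⟨fun hU => hr (h.subset hU), h.disjoint⟩
  · rw [← h.finish, walkLength, walkLength, hpos, hA]
    simp only [State.release]
    ring

theorem Following.completesAfter_release (h : Following c s S U V F e)
    (hf : s.future = r :: fut) (ht : s.time ≤ r.t) (hrF : r.t < F) (hr : r ∉ s.released)
    (hfar : Far K s) (hK : α * opt c (insert r s.released) < K)
    (hX : ∀ s' S' U', Following c s' S' U' (insert r V) F e → s'.future = fut → s'.time = r.t →
      s'.released = insert r s.released → Far K s' → CompletesAfter α B s' X) :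
    CompletesAfter α B s X := by
  induction S generalizing s U with
  | nil =>
    have hF : s.time = F := by simpa [walkLength] using h.finish
    linarith
  | cons A S ih =>
    refine .of_step (fun hs => absurd hs (State.not_completed_of_future hf)) ?_
    rcases le_or_gt r.t (s.time + |A.loc - s.pos|) with hle | hlt
    · rw [State.step_eq_release hf (by rw [h.nextEvent_cons]; exact_mod_cast hle)]
      obtain ⟨h', hpos⟩ := h.release (fut := fut) ht hle hr
      have hfar' : Far K (s.release r fut) := hfar.move rfl hpos.le
      rw [hfar'.react hK]
      exact hX _ _ _ h' rfl rfl rfl hfar'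
    · rw [State.step_eq_act fun r' hr' => ?_, h.act_cons]
      · obtain ⟨U', hU'⟩ := h.perform
        exact ih hU' hf hlt.le hr (hfar.perform _ _) hK hX
      · obtain rfl : r = r' := by simpa [hf] using hr'
        rw [h.nextEvent_cons]
        exact_mod_cast hlt

theorem Following.completesAfter_append (hc : 1 ≤ c) (hα : 0 ≤ α)
    (h : Following c s S U V F e) (hf : s.future = rs ++ late)
    (hrs : rs.Pairwise (·.t < ·.t))
    (hr : ∀ r ∈ rs, r ∉ s.released ∧ s.time ≤ r.t ∧ r.t < F)
    (hlate : ∀ r ∈ late.head?, F < r.t) (hfar : Far K s)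
    (hK : α * opt c (s.released ∪ rs.toFinset) < K) (hV : V ∪ rs.toFinset = ∅ → X ≤ F)
    (hX : CompletesAfter α B
      (.idleAt F e (V ∪ rs.toFinset) (s.released ∪ rs.toFinset) late) X) :
    CompletesAfter α B s X := by
  induction rs generalizing s S U V with
  | nil =>
    simp only [List.nil_append, List.toFinset_nil, Finset.union_empty] at *
    exact h.completesAfter hV (hf ▸ hlate) (hf ▸ hX)
  | cons r rs ih =>
    simp only [List.forall_mem_cons, List.pairwise_cons, List.toFinset_cons,
      Finset.union_insert] at *
    simp only [← Finset.insert_union] at *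
    have hKr : α * opt c (insert r s.released) < K :=
      (mul_le_mul_of_nonneg_left (opt_mono hc Finset.subset_union_left) hα).trans_lt hK
    refine h.completesAfter_release hf hr.1.2.1 hr.1.2.2 hr.1.1 hfar hKr ?_
    intro s' S' U' h' hf' ht' hr' hfar'
    refine ih h' hf' hrs.2 (fun q hq => ?_) hfar' (hr' ▸ hK) hV (hr' ▸ hX)
    obtain ⟨hqs, -, hqF⟩ := hr.2 q hq
    have hqr : q ≠ r := by rintro rfl; exact lt_irrefl _ (hrs.1 q hq)
    rw [hr', ht']
    exact ⟨by simp [hqr, hqs], (hrs.1 q hq).le, hqF⟩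

theorem lt_of_mem_head?_append {m : ℝ} (hrs : ∀ r ∈ rs, m < r.t)
    (hlate : ∀ r ∈ late.head?, m < r.t) : ∀ r ∈ (rs ++ late).head?, m < r.t := by
  cases rs with
  | nil => simpa using hlate
  | cons q rs => simpa using hrs q List.mem_cons_self

theorem completesAfter_idleAt_of_following (ht : α * opt c H ≤ t) (hV : V.Nonempty)
    (hVH : V ⊆ H) (hf : ∀ r ∈ fut.head?, t < r.t)
    (hX : ∀ s, Following c s (B.sched H t V p) V ∅ (t + walkLength p (B.sched H t V p))
      (endPos p (B.sched H t V p)) → s.time = t → s.pos = p → s.released = H → s.future = fut →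
      CompletesAfter α B s X) :
    CompletesAfter α B (.idleAt t p V H fut) X := by
  refine .of_step (fun hs => absurd hs (State.not_completed_of_pending hV)) ?_
  rw [State.step_eq_act fun r hr => by simpa [State.nextEvent, hV] using hf r hr]
  refine hX _ ⟨?_, ?_, ?_, by simp, ?_, ?_, ?_⟩ ?_ ?_ ?_ ?_ <;>
    simp [State.act, ht.not_gt, hV, hVH, (B.sched_spec H t V p).1]

theorem completesAfter_idleAt_of_le_pos (hc : 1 ≤ c) (hα : 0 ≤ α) (ht : α * opt c H ≤ t)
    (hV : V.Nonempty) (hVH : V ⊆ H) (hrs : rs.Pairwise (·.t < ·.t)) (hne : rs ≠ [])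
    (hr : ∀ r ∈ rs, r ∉ H ∧ t < r.t ∧ r.t < t + walkLength p (B.sched H t V p))
    (hlate : ∀ r ∈ late.head?, t + walkLength p (B.sched H t V p) < r.t)
    (hK : α * opt c (H ∪ rs.toFinset) < t + |p|)
    (hX : CompletesAfter α B (.idleAt (t + walkLength p (B.sched H t V p))
      (endPos p (B.sched H t V p)) rs.toFinset (H ∪ rs.toFinset) late) X) :
    CompletesAfter α B (.idleAt t p V H (rs ++ late)) X := by
  have hhead := lt_of_mem_head?_append (fun r hr' => (hr r hr').2.1) fun r hr' =>
    (le_add_of_nonneg_right (walkLength_nonneg p (B.sched H t V p))).trans_lt (hlate r hr')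
  refine completesAfter_idleAt_of_following ht hV hVH hhead fun s h hst hsp hsH hsf => ?_
  refine h.completesAfter_append (K := t + |p|) hc hα hsf hrs (fun r hr' => ?_) hlate (.inl ?_)
    (by rwa [hsH]) (by simp [hne]) (by simpa [hsH] using hX)
  · rw [hsH, hst]
    exact ⟨(hr r hr').1, (hr r hr').2.1.le, (hr r hr').2.2⟩
  · rw [hst, hsp]

theorem completesAfter_idleAt_of_load (hc : 1 ≤ c) (hα : 0 ≤ α) (ht : α * opt c H ≤ t)
    (hVH : V ⊆ H) (hload : B.sched H t V r.a = .load r :: S)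
    (hrs : rs.Pairwise (·.t < ·.t)) (hne : rs ≠ [])
    (hr : ∀ r' ∈ rs, r' ∉ H ∧ t < r'.t ∧ r'.t < t + walkLength r.a (B.sched H t V r.a))
    (hlate : ∀ r' ∈ late.head?, t + walkLength r.a (B.sched H t V r.a) < r'.t)
    (hK : α * opt c (H ∪ rs.toFinset) < t + |r.b - r.a| + |r.b|)
    (hX : CompletesAfter α B (.idleAt (t + walkLength r.a (B.sched H t V r.a))
      (endPos r.a (B.sched H t V r.a)) rs.toFinset (H ∪ rs.toFinset) late) X) :
    CompletesAfter α B (.idleAt t r.a V H (rs ++ late)) X := by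
  have hV : V.Nonempty := by
    have := (B.sched_spec H t V r.a).1
    rw [hload] at this
    exact ⟨r, this.1⟩
  have hhead := lt_of_mem_head?_append (fun q hq => (hr q hq).2.1) fun q hq =>
    (le_add_of_nonneg_right (walkLength_nonneg r.a (B.sched H t V r.a))).trans_lt (hlate q hq)
  refine completesAfter_idleAt_of_following ht hV hVH hhead fun s h hst hsp hsH hsf => ?_
  rw [hload] at h
  refine .of_step (fun hs => absurd hs (State.not_completed_of_pending (by simpa [h.pending]))) ?_
  rw [State.step_eq_act fun q hq => ?_, h.act_cons]
  · obtain ⟨U, hU⟩ := h.perform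
    rw [← hload] at hU
    refine hU.completesAfter_append (K := t + |r.b - r.a| + |r.b|) hc hα hsf hrs
      (fun q hq => ?_) hlate (.inr ⟨r, by simp [State.perform], ?_⟩)
      (by simpa [State.perform, hsH] using hK) (by simp [hne])
      (by simpa [State.perform, hsH] using hX)
    · simpa [State.perform, hsH, hst, hsp, Action.loc] using
        ⟨(hr q hq).1, (hr q hq).2.1.le, (hr q hq).2.2⟩
    · simp [State.perform, hst, hsp, Action.loc]
  · simpa [h.nextEvent_cons, hst, hsp, Action.loc] using hhead q (hsf ▸ hq)

theorem completesAfter_idleAt_last {d : ℝ} (hVH : V ⊆ H) (hV : V.Nonempty)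
    (hd : ∀ S, Serves c ∅ V S → d ≤ walkLength p S) :
    CompletesAfter α B (.idleAt t p V H []) (t + d) := by
  refine completesAfter_idleAt_of_max (by simp [hV.ne_empty]) (by simp) ?_
  refine completesAfter_idleAt_of_following (le_max_right _ _) hV hVH (by simp)
    fun s h _ _ _ hsf => ?_
  have hF := add_le_add (le_max_left t (α * opt c H))
    (hd _ (B.sched_spec H (max t (α * opt c H)) V p).1)
  exact h.completesAfter (fun _ => hF) (by simp [hsf]) (hsf ▸ completesAfter_idleAt_nil hF)

/-! ### Waiting in the origin -/

theorem completesAfter_release_origin (hf : s.future = r :: fut)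
    (hn : (r.t : WithTop ℝ) ≤ s.nextEvent c α) (hl : s.loaded = ∅) (hp : s.pos = 0)
    (hh : s.cmd.heading 0 = 0) (ht : s.time ≤ r.t)
    (hr : r.t < α * opt c (insert r s.released)) (hfut : ∀ r' ∈ fut.head?, r.t < r'.t)
    (hX : CompletesAfter α B (.waitingAt r.t (α * opt c (insert r s.released)) 0
      (insert r s.pending) (insert r s.released) fut) X) :
    CompletesAfter α B s X := by
  have hV : (insert r s.pending).Nonempty := Finset.insert_nonempty _ _
  have hrel : s.release r fut =
      ⟨r.t, 0, ∅, insert r s.pending, insert r s.released, fut, s.cmd⟩ := by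
    simp [State.release, hp, hh, hl, moveToward, ht]
  have hret : B.ret (insert r s.released) r.t ∅ 0 = [] := (B.ret_spec _ _ _ _).1.eq_nil
  have hreact : (s.release r fut).react α B =
      ⟨r.t, 0, ∅, insert r s.pending, insert r s.released, fut, .deliverAndReturn []⟩ := by
    simp [hrel, State.react, hret, returnLength, walkLength, endPos, hr.le]
  refine .of_step (fun hs => absurd hs (State.not_completed_of_future hf)) ?_
  rw [State.step_eq_release hf hn, hreact]
  refine .of_step (fun hs => absurd hs (State.not_completed_of_pending hV)) ?_
  rw [State.step_eq_act fun r' hr' => by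
    simpa [State.nextEvent, Command.heading] using hfut r' hr']
  simpa [State.act, State.idleAt] using
    completesAfter_idleAt_of_lt (p := 0) (by simp [hV.ne_empty]) hr hfut hX

theorem completesAfter_waitingAt_append (hc : 1 ≤ c) (hα : 0 ≤ α) (hH : H.Nonempty)
    (hrs : rs.Pairwise (·.t < ·.t)) (hr : ∀ r ∈ rs, t ≤ r.t ∧ r.t < α * opt c H)
    (hlate : ∀ r ∈ late.head?, α * opt c (H ∪ rs.toFinset) < r.t)
    (hX : CompletesAfter α B (.idleAt (α * opt c (H ∪ rs.toFinset)) 0 (H ∪ rs.toFinset)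
      (H ∪ rs.toFinset) late) X) :
    CompletesAfter α B (.waitingAt t (α * opt c H) 0 H H (rs ++ late)) X := by
  induction rs generalizing t H with
  | nil =>
    simp only [List.toFinset_nil, Finset.union_empty] at hlate hX
    exact completesAfter_waitingAt (by simp [hH.ne_empty]) hlate hX
  | cons r rs ih =>
    simp only [List.forall_mem_cons, List.pairwise_cons, List.toFinset_cons,
      Finset.union_insert, ← Finset.insert_union] at *
    have hle : α * opt c H ≤ α * opt c (insert r H) :=
      mul_le_mul_of_nonneg_left (opt_mono hc (Finset.subset_insert r H)) hα
    refine completesAfter_release_origin rfl (WithTop.coe_le_coe.2 hr.1.2.le)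
      rfl rfl rfl hr.1.1 (hr.1.2.trans_le hle)
      (lt_of_mem_head?_append hrs.1 fun q hq => ?_)
      (ih (Finset.insert_nonempty r H) hrs.2
        (fun q hq => ⟨(hrs.1 q hq).le, (hr.2 q hq).2.trans_le hle⟩) hlate hX)
    refine (hr.1.2.trans_le (hle.trans ?_)).trans (hlate q hq)
    exact mul_le_mul_of_nonneg_left (opt_mono hc Finset.subset_union_left) hα

theorem completesAfter_init_append (hc : 1 ≤ c) (hα : 0 ≤ α) (h0 : 0 ≤ r.t)
    (hrs : (r :: rs).Pairwise (·.t < ·.t)) (hr : ∀ q ∈ r :: rs, q.t < α * opt c {r})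
    (hlate : ∀ q ∈ late.head?, α * opt c (r :: rs).toFinset < q.t)
    (hX : CompletesAfter α B (.idleAt (α * opt c (r :: rs).toFinset) 0 (r :: rs).toFinset
      (r :: rs).toFinset late) X) :
    CompletesAfter α B (.init (r :: rs ++ late)) X := by
  rw [List.pairwise_cons] at hrs
  rw [List.forall_mem_cons] at hr
  rw [List.toFinset_cons, Finset.insert_eq] at hlate hX
  refine completesAfter_release_origin (by rfl) (by simp [State.nextEvent, State.init, opt_empty])
    rfl rfl rfl h0 hr.1 (lt_of_mem_head?_append hrs.1 fun q hq => ?_)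
    (completesAfter_waitingAt_append hc hα (Finset.singleton_nonempty r) hrs.2
      (fun q hq => ⟨(hrs.1 q hq).le, hr.2 q hq⟩) hlate hX)
  refine (hr.1.trans_le ?_).trans (hlate q hq)
  exact mul_le_mul_of_nonneg_left (opt_mono hc Finset.subset_union_left) hα

/-! ### Lower bounds on the competitive ratio -/

theorem IsRequestSequence.nodup (h : IsRequestSequence σ) : σ.Nodup :=
  h.2.imp fun hlt => by rintro rfl; exact lt_irrefl _ hlt

theorem IsRequestSequence.notMem_toFinset_of_append (h : IsRequestSequence (rs ++ late))
    (hr : r ∈ late) : r ∉ rs.toFinset :=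
  fun hr' => List.disjoint_of_nodup_append h.nodup (List.mem_toFinset.1 hr') hr

theorem IsRequestSequence.opt_le_of_perm (h : IsRequestSequence σ) (hc : 1 ≤ c)
    (hrs : rs.Perm σ) (S : List (ℝ × Action)) (hS : S.map Prod.snd = serial rs)
    (ht : Timely 0 0 S) : opt c σ.toFinset ≤ completion 0 S :=
  opt_le S (hS ▸ serves_serial hc (hrs.nodup_iff.2 h.nodup) (List.toFinset_eq_of_perm _ _ hrs)) ht

theorem le_competitiveRatio {X T : ℝ → ℝ} (hX : ContinuousAt X 0) (hT : ContinuousAt T 0)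
    (h0 : 0 < T 0)
    (h : ∀ᶠ ε in 𝓝[>] 0, ∃ σ, IsRequestSequence σ ∧ σ ≠ [] ∧ opt c σ.toFinset ≤ T ε ∧
      CompletesAfter α B (.init σ) (X ε)) :
    ENNReal.ofReal (X 0 / T 0) ≤ competitiveRatio α B := by
  have hlim : Tendsto (fun ε => ENNReal.ofReal (X ε / T ε)) (𝓝[>] 0)
      (𝓝 (ENNReal.ofReal (X 0 / T 0))) :=
    (ENNReal.tendsto_ofReal (hX.div hT h0.ne')).mono_left nhdsWithin_le_nhds
  refine le_of_tendsto hlim ?_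
  have hpos : ∀ᶠ ε in 𝓝[>] 0, 0 < T ε := (hT.eventually_const_lt h0).filter_mono nhdsWithin_le_nhds
  filter_upwards [h, hpos] with ε ⟨σ, hσ, hne, hopt, hlazy⟩ hTε
  calc ENNReal.ofReal (X ε / T ε)
      = ENNReal.ofReal (X ε) / ENNReal.ofReal (T ε) := ENNReal.ofReal_div_of_pos hTε
    _ ≤ lazyTime α B σ / ENNReal.ofReal (opt c σ.toFinset) :=
        ENNReal.div_le_div hlazy.le_lazyTime (ENNReal.ofReal_le_ofReal hopt)
    _ ≤ competitiveRatio α B := le_iSup_of_le σ (le_iSup₂_of_le hσ hne le_rfl)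

theorem eventually_pos_lt {m : ℝ} (hm : 0 < m) : ∀ᶠ ε in 𝓝[>] (0 : ℝ), 0 < ε ∧ ε < m :=
  Ioo_mem_nhdsGT hm

theorem one_add_le_competitiveRatio (hc : 1 ≤ c) (hα : 0 < α) :
    ENNReal.ofReal (1 + α) ≤ competitiveRatio α B := by
  have h : ContinuousAt (fun ε : ℝ => 1 + ε) 0 := by fun_prop
  refine (ENNReal.ofReal_le_ofReal ?_).trans
    (le_competitiveRatio (X := fun _ => 1 + α) (T := fun ε => 1 + ε) (by fun_prop)
    h (by norm_num) ?_)
  · norm_num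
  filter_upwards [eventually_pos_lt hα] with ε ⟨h0, hε⟩
  have hσ : IsRequestSequence [⟨1, 1, ε⟩] := by simp [IsRequestSequence, h0]
  have hopt : 1 ≤ opt c {⟨1, 1, ε⟩} := by
    simpa using abs_b_le_opt hc (Finset.mem_singleton_self (⟨1, 1, ε⟩ : Request))
  have hαopt : α ≤ α * opt c {⟨1, 1, ε⟩} := le_mul_of_one_le_right hα.le hopt
  refine ⟨_, hσ, by simp, ?_, ?_⟩
  · refine hσ.opt_le_of_perm hc (.refl _) [(1 + ε, .load ⟨1, 1, ε⟩), (1 + ε, .unload ⟨1, 1, ε⟩)]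
      rfl ?_
    simp only [timely_cons_load, timely_cons_unload, timely_nil, and_true]
    and_intros <;> linarith
  · refine completesAfter_init_append (rs := []) (late := []) hc hα.le h0.le (by simp)
      (by simpa using hε.trans_le hαopt) (by simp) ?_
    refine (completesAfter_idleAt_last (d := 1) subset_rfl (by simp) fun S hS => ?_).mono ?_
    · simpa using hS.abs_add_abs_le_walkLength (r := ⟨1, 1, ε⟩) (by simp) 0
    · rw [add_comm]
      exact add_le_add_left hαopt 1

theorem three_le_competitiveRatio_zero (hc : 1 ≤ c) (B : TieBreaking c) :
    ENNReal.ofReal 3 ≤ competitiveRatio 0 B := by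
  refine (ENNReal.ofReal_le_ofReal ?_).trans
    (le_competitiveRatio (X := fun ε => ε + 1 + 2) (T := fun ε => 1 + 2 * ε) (by fun_prop)
    (by fun_prop) (by norm_num) ?_)
  · norm_num
  filter_upwards [eventually_pos_lt one_pos] with ε ⟨h0, hε⟩
  have hσ : IsRequestSequence [⟨1, 1, ε⟩, ⟨0, 1, 2 * ε⟩] := by
    simp [IsRequestSequence, h0]
  obtain ⟨he, hw⟩ := (B.sched_spec {⟨1, 1, ε⟩} ε {⟨1, 1, ε⟩} 0).singleton hc
  refine ⟨_, hσ, by simp, ?_, ?_⟩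
  · refine hσ.opt_le_of_perm hc (.swap _ _ _) [(2 * ε, .load ⟨0, 1, 2 * ε⟩),
      (1 + 2 * ε, .unload ⟨0, 1, 2 * ε⟩), (1 + 2 * ε, .load ⟨1, 1, ε⟩),
      (1 + 2 * ε, .unload ⟨1, 1, ε⟩)] rfl ?_
    simp only [timely_cons_load, timely_cons_unload, timely_nil, and_true]
    and_intros <;> linarith
  · have hrel : (State.init [⟨1, 1, ε⟩, ⟨0, 1, 2 * ε⟩]).release ⟨1, 1, ε⟩ [⟨0, 1, 2 * ε⟩] =
        .idleAt ε 0 {⟨1, 1, ε⟩} {⟨1, 1, ε⟩} [⟨0, 1, 2 * ε⟩] := by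
      simp [State.release, State.init, State.idleAt, Command.heading, moveToward, h0.le]
    refine .of_step (fun hs => absurd hs (State.not_completed_of_future rfl)) ?_
    rw [State.step_eq_release rfl (by simp [State.nextEvent, State.init]), hrel,
      Far.react (K := ε) (.inl (by simp)) (by simpa using h0)]
    refine completesAfter_idleAt_of_le_pos (rs := [⟨0, 1, 2 * ε⟩]) (late := []) hc le_rfl
      (by simpa using h0.le) (by simp) subset_rfl (by simp) (by simp) ?_ (by simp)
      (by simpa using h0) ?_
    · simpa [hw] using ⟨(by linarith : ε < 2 * ε), (by linarith : 2 * ε < ε + 1)⟩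
    · rw [he, hw]
      refine (completesAfter_idleAt_last (d := 2) (by simp) (by simp) fun S hS => ?_).mono ?_
      · have := hS.abs_add_abs_le_walkLength (r := ⟨0, 1, 2 * ε⟩) (by simp) 1
        norm_num at this ⊢
        linarith
      · norm_num

/-- Requests that make a server waiting in `0` drive to `1`, loaded from the start. -/
noncomputable def outboundRequests (ε : ℝ) : List Request :=
  [⟨0, 1 / 2, ε⟩, ⟨1, 1, 2 * ε⟩]

/-- Requests released right after time `b` that make a server which is on its way to `1` drive
to `0` afterwards. -/
noncomputable def inboundRequests (b ε : ℝ) : List Request :=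
  [⟨0, 0, b + ε⟩, ⟨1 / 2 + ε, 1, b + 2 * ε⟩]

/-- The sequence that sends the server from `0` to `1`, back to `0`, and to `1` again. -/
noncomputable def zigzagRequests (b ε : ℝ) : List Request :=
  outboundRequests ε ++ (inboundRequests b ε ++ [⟨1, 1, b + 1 + 3 * ε⟩])

theorem exists_cons_of_isShortestSchedule_outbound (hc : 1 ≤ c)
    (h : IsShortestSchedule c (outboundRequests ε).toFinset 0 S) :
    endPos 0 S = 1 ∧ walkLength 0 S = 1 ∧ ∃ S', S = .load ⟨0, 1 / 2, ε⟩ :: S' := by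
  have hsub := h.1.load_unload_sublist (r := ⟨1, 1, 2 * ε⟩) (by simp [outboundRequests])
  have hle : walkLength 0 S ≤ 1 := by
    have := h.2 _ (serves_serial hc (by simp [outboundRequests]) rfl)
    norm_num [outboundRequests, serial, walkLength, Action.loc] at this
    exact this
  have hlen : walkLength 0 [.load ⟨1, 1, 2 * ε⟩, .unload ⟨1, 1, 2 * ε⟩] = 1 := by
    simp [walkLength, Action.loc]
  refine ⟨endPos_eq_of_sublist hsub (hle.trans hlen.ge), hle.antisymm ?_, ?_⟩
  · exact hlen.ge.trans (walkLength_le_of_sublist hsub 0)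
  obtain ⟨r, hr, S, rfl, hS⟩ := h.1.exists_load_cons ⟨⟨1, 1, 2 * ε⟩, by simp [outboundRequests]⟩
  simp only [outboundRequests, List.toFinset_cons, List.toFinset_nil, Finset.mem_insert,
    Finset.notMem_empty, or_false] at hr
  obtain rfl | rfl := hr
  · exact ⟨S, rfl⟩
  · have := hS.load_unload_sublist (r := ⟨0, 1 / 2, ε⟩) (by simp [outboundRequests])
    have := walkLength_le_of_sublist (this.cons_cons (.load ⟨1, 1, 2 * ε⟩)) 0
    norm_num [walkLength, Action.loc] at this hle
    linarith

theorem endPos_walkLength_of_isShortestSchedule_inbound (hc : 1 ≤ c) (h0 : 0 < ε)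
    (hε : ε < 1 / 2) (h : IsShortestSchedule c (inboundRequests b ε).toFinset 1 S) :
    endPos 1 S = 0 ∧ walkLength 1 S = 2 - 2 * ε := by
  have e₁ : |1 / 2 + ε - 1| = 1 / 2 - ε := by rw [abs_of_neg (by linarith)]; ring
  have e₂ : |1 - (1 / 2 + ε)| = 1 / 2 - ε := by rw [abs_of_pos (by linarith)]; ring
  have e₃ : |1 / 2 + ε - 0| = 1 / 2 + ε := by rw [abs_of_pos (by linarith)]; ring
  have e₄ : |0 - (1 / 2 + ε)| = 1 / 2 + ε := by rw [abs_of_neg (by linarith)]; ring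
  have e₅ : |(0 : ℝ) - 1| = 1 := by norm_num
  have e₆ : |(1 : ℝ) - 0| = 1 := by norm_num
  have hle : walkLength 1 S ≤ 2 - 2 * ε := by
    refine (h.2 _ (serves_serial (rs := [⟨1 / 2 + ε, 1, b + 2 * ε⟩, ⟨0, 0, b + ε⟩]) hc
      (by simp) (by simp [inboundRequests, Finset.pair_comm]))).trans_eq ?_
    simp only [walkLength_serial_cons, walkLength_serial_nil, e₁, e₂, e₅, sub_self, abs_zero]
    ring
  have hload := h.1.load_unload_sublist (r := ⟨0, 0, b + ε⟩) (by simp [inboundRequests])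
  have hpair := h.1.load_unload_sublist (r := ⟨1 / 2 + ε, 1, b + 2 * ε⟩)
    (by simp [inboundRequests])
  have hlast : [.load ⟨1 / 2 + ε, 1, b + 2 * ε⟩, .unload ⟨1 / 2 + ε, 1, b + 2 * ε⟩,
      .load ⟨0, 0, b + ε⟩].Sublist S := by
    rcases insert_pair_sublist hpair (hload.subset List.mem_cons_self) (by simp) (by simp)
      with hsub | hsub | hsub
    · have := walkLength_le_of_sublist hsub 1
      simp only [walkLength, Action.loc, e₂, e₃, e₅] at this
      linarith
    · have := walkLength_le_of_sublist hsub 1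
      simp only [walkLength, Action.loc, e₁, e₄, e₆] at this
      linarith
    · exact hsub
  have hlen : walkLength 1 [.load ⟨1 / 2 + ε, 1, b + 2 * ε⟩,
      .unload ⟨1 / 2 + ε, 1, b + 2 * ε⟩, .load ⟨0, 0, b + ε⟩] = 2 - 2 * ε := by
    simp only [walkLength, Action.loc, e₁, e₂, e₅]
    ring
  exact ⟨endPos_eq_of_sublist hlast (hle.trans hlen.ge),
    hle.antisymm (hlen.ge.trans (walkLength_le_of_sublist hlast 1))⟩

theorem isRequestSequence_zigzagRequests (h0 : 0 < ε) (hb : ε < b) :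
    IsRequestSequence (zigzagRequests b ε) := by
  simp only [IsRequestSequence, zigzagRequests, outboundRequests, inboundRequests,
    List.cons_append, List.nil_append, List.forall_mem_cons, List.pairwise_cons,
    List.not_mem_nil, false_imp_iff, implies_true, and_true, List.Pairwise.nil]
  and_intros <;> linarith

theorem opt_zigzagRequests_le (hc : 1 ≤ c) (h0 : 0 < ε) (hb : ε < b) (hε : ε ≤ 1 / 2) :
    opt c (zigzagRequests b ε).toFinset ≤ b + 1 + 3 * ε := by
  let r₁ : Request := ⟨0, 1 / 2, ε⟩
  let r₂ : Request := ⟨1, 1, 2 * ε⟩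
  let r₃ : Request := ⟨0, 0, b + ε⟩
  let r₄ : Request := ⟨1 / 2 + ε, 1, b + 2 * ε⟩
  let r₅ : Request := ⟨1, 1, b + 1 + 3 * ε⟩
  have hperm : [r₃, r₁, r₄, r₂, r₅].Perm [r₁, r₂, r₃, r₄, r₅] :=
    .trans (.swap _ _ _) (.cons _ (.trans (.cons _ (.swap _ _ _)) (.swap _ _ _)))
  refine (isRequestSequence_zigzagRequests h0 hb).opt_le_of_perm hc hperm
    [(b + 2 * ε, .load r₃), (b + 2 * ε, .unload r₃),
    (b + 2 * ε, .load r₁), (b + 1 / 2 + 2 * ε, .unload r₁),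
    (b + 1 / 2 + 3 * ε, .load r₄), (b + 1 + 2 * ε, .unload r₄),
    (b + 1 + 2 * ε, .load r₂), (b + 1 + 2 * ε, .unload r₂),
    (b + 1 + 3 * ε, .load r₅), (b + 1 + 3 * ε, .unload r₅)] rfl ?_
  simp only [timely_cons_load, timely_cons_unload, timely_nil, and_true]
  dsimp only [r₁, r₂, r₃, r₄, r₅]
  and_intros <;> linarith

theorem opt_outbound_le (hc : 1 ≤ c) (h0 : 0 < ε) :
    opt c (outboundRequests ε).toFinset ≤ 1 + 2 * ε := by
  refine opt_le [(2 * ε, .load ⟨0, 1 / 2, ε⟩), (1 / 2 + 2 * ε, .unload ⟨0, 1 / 2, ε⟩),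
    (1 + 2 * ε, .load ⟨1, 1, 2 * ε⟩), (1 + 2 * ε, .unload ⟨1, 1, 2 * ε⟩)]
    (serves_serial hc (by simp [outboundRequests]) rfl) ?_
  simp only [timely_cons_load, timely_cons_unload, timely_nil, and_true]
  and_intros <;> linarith

theorem one_le_opt_outbound (hc : 1 ≤ c) : 1 ≤ opt c (outboundRequests ε).toFinset := by
  simpa using abs_b_le_opt hc
    (by simp [outboundRequests] : (⟨1, 1, 2 * ε⟩ : Request) ∈ (outboundRequests ε).toFinset)

theorem mul_opt_lt_of_subset_zigzagRequests (hc : 1 ≤ c) (hα : 0 ≤ α) (h0 : 0 < ε) (hb : ε < b)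
    (hε : α + 3 * ε < 1) (hR : R ⊆ (zigzagRequests b ε).toFinset) : α * opt c R < b + 1 := by
  calc α * opt c R ≤ α * (b + 1 + 3 * ε) := mul_le_mul_of_nonneg_left
        ((opt_mono hc hR).trans (opt_zigzagRequests_le hc h0 hb (by linarith))) hα
    _ < b + 1 := by nlinarith

theorem completesAfter_idleAt_inbound (hc : 1 ≤ c) (hα : 0 ≤ α) (h0 : 0 < ε) (hb : ε < b)
    (hε : α + 3 * ε < 1) :
    CompletesAfter α B (.idleAt (b + 1) 1 (inboundRequests b ε).toFinset
      ((outboundRequests ε).toFinset ∪ (inboundRequests b ε).toFinset) [⟨1, 1, b + 1 + 3 * ε⟩])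
      (b + 4 - 2 * ε) := by
  have hlt : ∀ R ⊆ (zigzagRequests b ε).toFinset, α * opt c R < b + 1 := fun R hR =>
    mul_opt_lt_of_subset_zigzagRequests hc hα h0 hb hε hR
  obtain ⟨hend, hlen⟩ := endPos_walkLength_of_isShortestSchedule_inbound hc h0 (by linarith)
    (B.sched_spec ((outboundRequests ε).toFinset ∪ (inboundRequests b ε).toFinset) (b + 1)
      (inboundRequests b ε).toFinset 1)
  have hσ : IsRequestSequence
      ((outboundRequests ε ++ inboundRequests b ε) ++ [⟨1, 1, b + 1 + 3 * ε⟩]) := by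
    simpa [zigzagRequests] using isRequestSequence_zigzagRequests h0 hb
  have hnotMem := hσ.notMem_toFinset_of_append (List.mem_singleton_self _)
  rw [List.toFinset_append] at hnotMem
  refine completesAfter_idleAt_of_le_pos (rs := [⟨1, 1, b + 1 + 3 * ε⟩]) (late := []) hc hα
    (hlt _ ?_).le (by simp [inboundRequests]) Finset.subset_union_right (by simp) (by simp)
    ?_ (by simp) ?_ ?_
  · simp [zigzagRequests]
  · rw [hlen, List.forall_mem_singleton]
    exact ⟨hnotMem, by linarith, by linarith⟩
  · refine (hlt _ (by simp [zigzagRequests])).trans ?_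
    norm_num
  · rw [hend, hlen]
    refine (completesAfter_idleAt_last (d := 1) (by simp) (by simp) fun S hS => ?_).mono
      (by linarith)
    simpa using hS.abs_add_abs_le_walkLength (r := ⟨1, 1, b + 1 + 3 * ε⟩) (by simp) 0

theorem completesAfter_idleAt_outbound (hc : 1 ≤ c) (hα : 0 ≤ α) (h0 : 0 < ε) (hb : ε < b)
    (hε : α + 3 * ε < 1) (hopt : α * opt c (outboundRequests ε).toFinset ≤ b) :
    CompletesAfter α B (.idleAt b 0 (outboundRequests ε).toFinset (outboundRequests ε).toFinset
      (inboundRequests b ε ++ [⟨1, 1, b + 1 + 3 * ε⟩])) (b + 4 - 2 * ε) := by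
  have hσ := isRequestSequence_zigzagRequests h0 hb
  obtain ⟨hend, hlen, S, hS⟩ := exists_cons_of_isShortestSchedule_outbound hc (B.sched_spec
    (outboundRequests ε).toFinset b (outboundRequests ε).toFinset 0)
  refine completesAfter_idleAt_of_load (r := ⟨0, 1 / 2, ε⟩) hc hα hopt subset_rfl hS
    ?_ (by simp [inboundRequests]) ?_ ?_ ?_ ?_
  · simpa [inboundRequests] using by linarith
  · refine fun r hr => ⟨hσ.notMem_toFinset_of_append (List.mem_append_left _ hr), ?_⟩
    rw [hlen]
    revert r
    simp only [inboundRequests, List.forall_mem_cons, List.not_mem_nil, false_imp_iff,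
      implies_true, and_true]
    and_intros <;> linarith
  · rw [hlen]
    simpa using h0
  · refine (mul_opt_lt_of_subset_zigzagRequests (b := b) hc hα h0 hb hε ?_).trans_eq ?_
    · simp [zigzagRequests]
    · norm_num [add_assoc]
  · rw [hend, hlen]
    exact completesAfter_idleAt_inbound hc hα h0 hb hε

theorem completesAfter_init_zigzagRequests (hc : 1 ≤ c) (hα : 0 < α) (h0 : 0 < ε)
    (hεα : 4 * ε < α) (hε : α + 3 * ε < 1)
    (hb : b = α * opt c (outboundRequests ε).toFinset) :
    CompletesAfter α B (.init (zigzagRequests b ε)) (b + 4 - 2 * ε) := by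
  have hαb : α ≤ b := hb ▸ le_mul_of_one_le_right hα.le (one_le_opt_outbound hc)
  have hhalf : 1 / 2 ≤ opt c {⟨0, 1 / 2, ε⟩} :=
    (le_abs_self _).trans
      (abs_b_le_opt hc (Finset.mem_singleton_self (⟨0, 1 / 2, ε⟩ : Request)))
  have hwait : ∀ r ∈ outboundRequests ε, r.t < α * opt c {⟨0, 1 / 2, ε⟩} := by
    simp only [outboundRequests, List.forall_mem_cons, List.not_mem_nil, false_imp_iff,
      implies_true, and_true]
    constructor <;> nlinarith
  refine completesAfter_init_append hc hα.le h0.le (by simpa [two_mul] using h0) hwait ?_ ?_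
  · have : b < b + ε := by linarith
    simpa [inboundRequests, outboundRequests, hb] using this
  · have := completesAfter_idleAt_outbound (B := B) hc hα.le h0 (by linarith) hε hb.ge
    rwa [hb] at this ⊢

theorem one_add_three_div_le_competitiveRatio (hc : 1 ≤ c) (h0 : 0 < α) (h1 : α < 1) :
    ENNReal.ofReal (1 + 3 / (α + 1)) ≤ competitiveRatio α B := by
  refine (ENNReal.ofReal_le_ofReal ?_).trans
    (le_competitiveRatio (X := fun ε => α + 4 - 2 * ε)
    (T := fun ε => α * (1 + 2 * ε) + 1 + 3 * ε) (by fun_prop) (by fun_prop) (by linarith) ?_)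
  · apply le_of_eq
    field_simp
    ring
  filter_upwards [eventually_pos_lt (by linarith : 0 < α / 4),
    eventually_pos_lt (by linarith : 0 < (1 - α) / 3)] with ε ⟨hε, hεα⟩ ⟨_, hε'⟩
  obtain ⟨b, hb⟩ : ∃ b, b = α * opt c (outboundRequests ε).toFinset := ⟨_, rfl⟩
  have hαb : α ≤ b := hb ▸ le_mul_of_one_le_right h0.le (one_le_opt_outbound hc)
  have hbα : b ≤ α * (1 + 2 * ε) :=
    hb ▸ mul_le_mul_of_nonneg_left (opt_outbound_le hc hε) h0.le
  refine ⟨zigzagRequests b ε, isRequestSequence_zigzagRequests hε (by linarith),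
    by simp [zigzagRequests, outboundRequests],
    (opt_zigzagRequests_le hc hε (by linarith) (by linarith)).trans (by linarith),
    (completesAfter_init_zigzagRequests hc h0 hε (by linarith) (by linarith) hb).mono
      (by linarith)⟩

/-- Requests from the origin to `u > 0` and to `-v < 0`, together with a request from `p` to `q`
on the negative side that makes it preferable to visit `-v` before `u`. -/
def sweepRequests (u v p q ε : ℝ) : List Request :=
  [⟨0, u, ε⟩, ⟨0, -v, 2 * ε⟩, ⟨p, q, 3 * ε⟩]

/-- A schedule from the origin that walks to `-v` and then to `u`. The first request to be loaded
has to be delivered at distance at least `u` from the origin. -/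
structure IsLeftRightSweep (u v : ℝ) (S : List Action) : Prop where
  endPos_eq : endPos 0 S = u
  walkLength_eq : walkLength 0 S = 2 * v + u
  exists_load_cons : ∃ b t S', S = .load ⟨0, b, t⟩ :: S' ∧ u ≤ |b|

theorem isRequestSequence_sweepRequests_append (h0 : 0 < ε) (hb : 2 * ε < b) :
    IsRequestSequence (sweepRequests u v p q ε ++ [⟨y, z, b + ε⟩]) := by
  simp only [IsRequestSequence, sweepRequests, List.cons_append, List.nil_append,
    List.forall_mem_cons, List.pairwise_cons, List.not_mem_nil, false_imp_iff, implies_true,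
    and_true, List.Pairwise.nil]
  and_intros <;> linarith

theorem nodup_sweepRequests (h0 : 0 < ε) : (sweepRequests u v p q ε).Nodup :=
  (isRequestSequence_sweepRequests_append (b := 3 * ε) (y := 0) (z := 0) h0
    (by linarith)).nodup.of_append_left

theorem serves_sweepRequests (hc : 1 ≤ c) (h0 : 0 < ε) :
    Serves c ∅ (sweepRequests u v p q ε).toFinset
      (serial [⟨0, -v, 2 * ε⟩, ⟨p, q, 3 * ε⟩, ⟨0, u, ε⟩]) := by
  have hperm : [⟨0, -v, 2 * ε⟩, ⟨p, q, 3 * ε⟩, ⟨0, u, ε⟩].Perm (sweepRequests u v p q ε) :=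
    List.perm_append_comm (l₁ := [_, _]) (l₂ := [_])
  exact serves_serial hc (hperm.nodup_iff.2 (nodup_sweepRequests h0))
    (List.toFinset_eq_of_perm _ _ hperm)

theorem walkLength_le_of_isShortestSchedule_sweepRequests (hc : 1 ≤ c) (h0 : 0 < ε) (hu : 0 ≤ u)
    (hp : -v ≤ p) (hpq : p ≤ q) (hq : q ≤ 0)
    (h : IsShortestSchedule c (sweepRequests u v p q ε).toFinset 0 S) :
    walkLength 0 S ≤ 2 * v + u := by
  refine (h.2 _ (serves_sweepRequests hc h0)).trans_eq ?_
  simp only [walkLength_serial_cons, walkLength_serial_nil, sub_self, abs_zero, sub_zero, zero_sub,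
    abs_neg]
  rw [abs_of_nonneg (by linarith : 0 ≤ v), abs_of_nonneg (by linarith : 0 ≤ p - -v),
    abs_of_nonneg (sub_nonneg.2 hpq), abs_of_nonpos hq, abs_of_nonneg hu]
  ring

theorem IsShortestSchedule.load_unload_sublist_sweepRequests (hc : 1 ≤ c) (h0 : 0 < ε)
    (hu : 0 < u) (hv : 0 ≤ v) (hqu : -u < q) (hq : q ≤ 0) (hvq : -v ≤ q)
    (h : IsShortestSchedule c (sweepRequests u v (-v) q ε).toFinset 0 S) :
    [.load ⟨-v, q, 3 * ε⟩, .unload ⟨0, u, ε⟩].Sublist S := by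
  have h₁ := h.1.load_unload_sublist (r := ⟨0, u, ε⟩) (by simp [sweepRequests])
  have h₃ := h.1.load_unload_sublist (r := ⟨-v, q, 3 * ε⟩) (by simp [sweepRequests])
  have hε : ε ≠ 3 * ε := by linarith
  rcases insert_pair_sublist (a := Action.unload ⟨0, u, ε⟩) h₃ (h₁.subset (by simp)) (by simp)
    (by simp [hε]) with hsub | hsub | hsub
  · have hle := walkLength_le_of_isShortestSchedule_sweepRequests hc h0 hu.le le_rfl hvq hq h
    have hlt := walkLength_le_of_sublist hsub 0
    simp only [walkLength, Action.loc, sub_zero, abs_of_pos hu,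
      abs_of_neg (by linarith : -v - u < 0), abs_of_nonneg (by linarith : 0 ≤ q - -v)] at hlt
    linarith
  · exact (List.sublist_append_left [_, _] [_]).trans hsub
  · exact (List.Sublist.cons_cons _ (List.sublist_cons_self _ _)).trans hsub

theorem IsShortestSchedule.isLeftRightSweep (hc : 1 ≤ c) (h0 : 0 < ε) (hu : 0 < u) (huv : u ≤ v)
    (hqu : -u < q) (hq : q ≤ 0)
    (h : IsShortestSchedule c (sweepRequests u v (-v) q ε).toFinset 0 S) :
    IsLeftRightSweep u v S := by
  have hle := walkLength_le_of_isShortestSchedule_sweepRequests hc h0 hu.le le_rfl (by linarith)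
    hq h
  have e₁ : |u - -v| = v + u := by rw [abs_of_pos (by linarith)]; ring
  have e₂ : |v| = v := abs_of_pos (by linarith)
  have hsub := h.load_unload_sublist_sweepRequests hc h0 hu (by linarith) hqu hq (by linarith)
  have hlen : walkLength 0 [.load ⟨-v, q, 3 * ε⟩, .unload ⟨0, u, ε⟩] = 2 * v + u := by
    simp only [walkLength, Action.loc, sub_zero, abs_neg, e₁, e₂]
    ring
  have hend : endPos 0 S = u := endPos_eq_of_sublist hsub (hle.trans hlen.ge)
  refine ⟨hend, hle.antisymm (hlen.ge.trans (walkLength_le_of_sublist hsub 0)), ?_⟩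
  obtain ⟨r, hr, S, rfl, hS⟩ := h.1.exists_load_cons ⟨⟨0, u, ε⟩, by simp [sweepRequests]⟩
  simp only [sweepRequests, List.toFinset_cons, List.toFinset_nil, Finset.mem_insert,
    Finset.notMem_empty, or_false] at hr
  rcases hr with rfl | rfl | rfl
  · exact ⟨_, _, S, rfl, le_abs_self u⟩
  · exact ⟨_, _, S, rfl, by rwa [abs_neg, e₂]⟩
  · have h₂ := hS.load_unload_sublist (r := ⟨0, -v, 2 * ε⟩) (by simp [sweepRequests, h0.ne'])
    have := walkLength_add_abs_endPos_sub_le_of_sublist (h₂.cons_cons (.load ⟨-v, q, 3 * ε⟩)) 0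
    rw [hend] at this
    simp only [walkLength, endPos, Action.loc, sub_zero, sub_neg_eq_add, zero_add,
      abs_neg] at this hle e₁
    rw [add_comm u, e₂, abs_of_pos (by linarith : 0 < v + u)] at this
    linarith

theorem IsShortestSchedule.isLeftRightSweep_one (h0 : 0 < ε) (huv : u ≤ v) (hvu : v < 3 * u)
    (hqu : -u < q) (hq : q < 0)
    (h : IsShortestSchedule 1 (sweepRequests u v (-u) q ε).toFinset 0 S) :
    IsLeftRightSweep u v S := by
  have hle := walkLength_le_of_isShortestSchedule_sweepRequests le_rfl h0 (by linarith)
    (by linarith) hqu.le hq.le h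
  have e₁ : |u| = u := abs_of_pos (by linarith)
  have e₂ : |v| = v := abs_of_pos (by linarith)
  have e₃ : |q| = -q := abs_of_neg hq
  have e₄ : |-u - -v| = v - u := by rw [abs_of_nonneg (by linarith)]; ring
  have e₅ : |q - -u| = q + u := by rw [abs_of_pos (by linarith)]; ring
  have e₆ : |-u - u| = 2 * u := by rw [abs_of_neg (by linarith)]; ring
  obtain ⟨rs, hn, hrs, rfl⟩ := h.1.exists_eq_serial
  have hperm := List.mem_permutations.2
    (List.perm_of_nodup_nodup_toFinset_eq hn (nodup_sweepRequests h0) hrs)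
  have hcases : rs = [⟨0, -v, 2 * ε⟩, ⟨-u, q, 3 * ε⟩, ⟨0, u, ε⟩] ∨
      2 * v + u < walkLength 0 (serial rs) := by
    simp only [sweepRequests, List.permutations, List.permutationsAux, List.permutationsAux.rec,
      List.permutationsAux2, List.foldr, List.mem_cons, List.not_mem_nil, or_false, id_eq] at hperm
    rcases hperm with rfl | rfl | rfl | rfl | rfl | rfl
    all_goals
      first
      | exact .inl rfl
      | right
        simp only [walkLength_serial_cons, walkLength_serial_nil, sub_self, abs_zero, sub_zero,
          zero_sub, abs_neg, e₁, e₂, e₃, e₄, e₅, e₆]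
        linarith
  obtain rfl := hcases.resolve_right hle.not_gt
  refine ⟨rfl, ?_, _, _, _, rfl, by rwa [abs_neg, e₂]⟩
  simp only [walkLength_serial_cons, walkLength_serial_nil, sub_self, abs_zero, sub_zero, zero_sub,
    abs_neg, e₁, e₂, e₃, e₄, e₅]
  ring

theorem le_opt_sweepRequests (hc : 1 ≤ c)
    (h : ∀ S, IsShortestSchedule c (sweepRequests u v p q ε).toFinset 0 S →
      IsLeftRightSweep u v S) : 2 * v + u ≤ opt c (sweepRequests u v p q ε).toFinset := by
  obtain ⟨B⟩ := TieBreaking.nonempty hc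
  have hB := B.sched_spec ∅ 0 (sweepRequests u v p q ε).toFinset 0
  exact le_opt hc fun S hS => (h _ hB).walkLength_eq.ge.trans (hB.2 S hS)

theorem opt_sweepRequests_le (hc : 1 ≤ c) (h0 : 0 < ε) (hu : 0 ≤ u)
    (hp : -v ≤ p) (hpq : p ≤ q) (hq : q ≤ 0) :
    opt c (sweepRequests u v p q ε).toFinset ≤ 2 * v + u + 3 * ε := by
  refine opt_le [(3 * ε, .load ⟨0, -v, 2 * ε⟩), (v + 3 * ε, .unload ⟨0, -v, 2 * ε⟩),
    (2 * v + p + 3 * ε, .load ⟨p, q, 3 * ε⟩), (2 * v + q + 3 * ε, .unload ⟨p, q, 3 * ε⟩),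
    (2 * v + 3 * ε, .load ⟨0, u, ε⟩), (2 * v + u + 3 * ε, .unload ⟨0, u, ε⟩)]
    (serves_sweepRequests hc h0) ?_
  simp only [timely_cons_load, timely_cons_unload, timely_nil, and_true]
  and_intros <;> linarith

theorem completesAfter_init_sweepRequests_append (hc : 1 ≤ c) (hα : 0 < α) (h0 : 0 < ε)
    (hv : 0 ≤ v) (hεα : 3 * ε < α * u) (hεu : ε < u)
    (h : ∀ S, IsShortestSchedule c (sweepRequests u v p q ε).toFinset 0 S →
      IsLeftRightSweep u v S)
    (hb : b = α * opt c (sweepRequests u v p q ε).toFinset)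
    (hopt : α * opt c (sweepRequests u v p q ε ++ [(⟨y, z, b + ε⟩ : Request)]).toFinset <
      b + 2 * u) :
    CompletesAfter α B (.init (sweepRequests u v p q ε ++ [⟨y, z, b + ε⟩]))
      (b + (2 * v + u) + (|y - u| + |z - y|)) := by
  have hsub : {⟨0, u, ε⟩} ⊆ (sweepRequests u v p q ε).toFinset := by simp [sweepRequests]
  have huopt : α * u ≤ α * opt c {⟨0, u, ε⟩} := by
    have := abs_b_le_opt hc (Finset.mem_singleton_self (⟨0, u, ε⟩ : Request))
    exact mul_le_mul_of_nonneg_left ((le_abs_self u).trans this) hα.le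
  have hub : α * u ≤ b :=
    hb ▸ huopt.trans (mul_le_mul_of_nonneg_left (opt_mono hc hsub) hα.le)
  have hσ : IsRequestSequence (sweepRequests u v p q ε ++ [⟨y, z, b + ε⟩]) :=
    isRequestSequence_sweepRequests_append h0 (by linarith)
  have hwait : ∀ r ∈ sweepRequests u v p q ε, r.t < α * opt c {⟨0, u, ε⟩} := by
    simp only [sweepRequests, List.forall_mem_cons, List.not_mem_nil, false_imp_iff,
      implies_true, and_true]
    and_intros <;> linarith
  refine completesAfter_init_append hc hα.le h0.le (List.pairwise_append.1 hσ.2).1 hwait ?_ ?_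
  · simp only [List.head?_cons, Option.mem_some_iff, forall_eq']
    exact hb.ge.trans_lt (lt_add_of_pos_right b h0)
  obtain ⟨hend, hlen, b', t', S, hS, hub'⟩ :=
    h _ (B.sched_spec (sweepRequests u v p q ε).toFinset b (sweepRequests u v p q ε).toFinset 0)
  change CompletesAfter α B (.idleAt (α * opt c (sweepRequests u v p q ε).toFinset) 0
    (sweepRequests u v p q ε).toFinset (sweepRequests u v p q ε).toFinset ([⟨y, z, b + ε⟩] ++ [])) _
  rw [← hb]
  refine completesAfter_idleAt_of_load (r := ⟨0, b', t'⟩) hc hα.le hb.ge subset_rfl hS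
    (by simp) (by simp) ?_ (by simp) ?_ ?_
  · rw [hlen, List.forall_mem_singleton]
    exact ⟨hσ.notMem_toFinset_of_append (List.mem_singleton_self _), by linarith, by linarith⟩
  · rw [← List.toFinset_append]
    refine hopt.trans_le ?_
    simp only [sub_zero]
    linarith
  · rw [hend, hlen]
    refine completesAfter_idleAt_last (by simp) (by simp) fun S hS => ?_
    exact hS.abs_add_abs_le_walkLength (r := ⟨y, z, b + ε⟩) (by simp) u

theorem opt_sweepRequests_append_le_one (h0 : 0 < ε) (hu : 0 ≤ u) (huv : u ≤ v) (hb : 2 * ε < b)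
    (hbv : b ≤ 2 * u + v + 3 * ε) :
    opt 1 (sweepRequests u v (-u) (-u + ε) ε ++ [(⟨-v, -u, b + ε⟩ : Request)]).toFinset ≤
      2 * v + u + 5 * ε := by
  let r₁ : Request := ⟨0, u, ε⟩
  let r₂ : Request := ⟨0, -v, 2 * ε⟩
  let r₃ : Request := ⟨-u, -u + ε, 3 * ε⟩
  let r₄ : Request := ⟨-v, -u, b + ε⟩
  have hperm : [r₁, r₂, r₄, r₃].Perm [r₁, r₂, r₃, r₄] := .cons _ (.cons _ (.swap _ _ _))
  refine (isRequestSequence_sweepRequests_append h0 hb).opt_le_of_perm le_rfl hperm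
    [(3 * ε, .load r₁), (u + 3 * ε, .unload r₁),
    (2 * u + 3 * ε, .load r₂), (2 * u + v + 3 * ε, .unload r₂),
    (2 * u + v + 4 * ε, .load r₄), (2 * v + u + 4 * ε, .unload r₄),
    (2 * v + u + 4 * ε, .load r₃), (2 * v + u + 5 * ε, .unload r₃)] rfl ?_
  simp only [timely_cons_load, timely_cons_unload, timely_nil, and_true]
  dsimp only [r₁, r₂, r₃, r₄]
  and_intros <;> linarith

theorem opt_sweepRequests_append_le_of_two_le (hc : 2 ≤ c) (h0 : 0 < ε) (hu : 0 ≤ u)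
    (huv : u ≤ v) (hb : 2 * ε < b) (hbv : b ≤ 2 * u + v + 3 * ε) :
    opt c (sweepRequests u v (-v) (-u + ε) ε ++ [(⟨-v, -u, b + ε⟩ : Request)]).toFinset ≤
      2 * v + u + 5 * ε := by
  let r₁ : Request := ⟨0, u, ε⟩
  let r₂ : Request := ⟨0, -v, 2 * ε⟩
  let r₃ : Request := ⟨-v, -u + ε, 3 * ε⟩
  let r₄ : Request := ⟨-v, -u, b + ε⟩
  have hnodup : [r₁, r₂, r₃, r₄].Nodup := (isRequestSequence_sweepRequests_append h0 hb).nodup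
  simp only [List.nodup_cons, List.mem_cons, List.not_mem_nil, or_false, not_or] at hnodup
  obtain ⟨⟨h₁₂, h₁₃, h₁₄⟩, ⟨h₂₃, h₂₄⟩, h₃₄, -⟩ := hnodup
  have hserves : Serves c ∅ {r₁, r₂, r₄, r₃}
      [.load r₁, .unload r₁, .load r₂, .unload r₂, .load r₄, .load r₃, .unload r₄, .unload r₃] :=
    ((serves_interleaved hc (Ne.symm h₃₄)).load_unload_cons (one_le_two.trans hc)
      (by simp [h₂₃, h₂₄])).load_unload_cons (one_le_two.trans hc) (by simp [h₁₂, h₁₃, h₁₄])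
  have hset : (sweepRequests u v (-v) (-u + ε) ε ++ [r₄]).toFinset = {r₁, r₂, r₄, r₃} := by
    simp [sweepRequests, r₁, r₂, r₃, Finset.pair_comm r₄]
  rw [hset]
  refine opt_le [(3 * ε, .load r₁), (u + 3 * ε, .unload r₁),
    (2 * u + 3 * ε, .load r₂), (2 * u + v + 3 * ε, .unload r₂),
    (2 * u + v + 4 * ε, .load r₄), (2 * u + v + 4 * ε, .load r₃),
    (2 * v + u + 4 * ε, .unload r₄), (2 * v + u + 5 * ε, .unload r₃)] hserves ?_
  simp only [timely_cons_load, timely_cons_unload, timely_nil, and_true]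
  dsimp only [r₁, r₂, r₃, r₄]
  and_intros <;> linarith

-- A server that is done with the other requests at time `3`, in `-1`, can be in `-(3 * α - 2)` at
-- time `3 * α`.
theorem opt_sweepRequests_append_le_three_mul (hc : 1 ≤ c) (h0 : 0 < ε) (hα : 1 ≤ α)
    (hb : 2 * ε < b) (hbα : b ≤ 3 * α + 5 * ε) :
    opt c (sweepRequests 1 1 (-1) (-1 + ε) ε ++
      [(⟨-(3 * α - 2), -(3 * α - 2), b + ε⟩ : Request)]).toFinset ≤ 3 * α + 6 * ε := by
  let r₁ : Request := ⟨0, 1, ε⟩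
  let r₂ : Request := ⟨0, -1, 2 * ε⟩
  let r₃ : Request := ⟨-1, -1 + ε, 3 * ε⟩
  let r₄ : Request := ⟨-(3 * α - 2), -(3 * α - 2), b + ε⟩
  refine (isRequestSequence_sweepRequests_append h0 hb).opt_le_of_perm hc
    (.refl [r₁, r₂, r₃, r₄])
    [(3 * ε, .load r₁), (1 + 3 * ε, .unload r₁),
    (2 + 3 * ε, .load r₂), (3 + 3 * ε, .unload r₂),
    (3 + 3 * ε, .load r₃), (3 + 4 * ε, .unload r₃),
    (3 * α + 6 * ε, .load r₄), (3 * α + 6 * ε, .unload r₄)] rfl ?_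
  simp only [timely_cons_load, timely_cons_unload, timely_nil, and_true]
  dsimp only [r₁, r₂, r₃, r₄]
  and_intros <;> linarith

theorem two_add_div_le_competitiveRatio (hc : 1 ≤ c) (h1 : 1 ≤ α) (h2 : 3 * α ^ 2 < 3 * α + 2) :
    ENNReal.ofReal (2 + 2 / (3 * α)) ≤ competitiveRatio α B := by
  have : α < 5 / 3 := by nlinarith
  refine (ENNReal.ofReal_le_ofReal ?_).trans
    (le_competitiveRatio (X := fun _ => 6 * α + 2) (T := fun ε => 3 * α + 6 * ε)
    (by fun_prop) (by fun_prop) (by linarith) ?_)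
  · apply le_of_eq
    field_simp
    ring
  filter_upwards [eventually_pos_lt (by norm_num : (0 : ℝ) < 1 / 3),
    eventually_pos_lt (by linarith : 0 < (3 * α + 2 - 3 * α ^ 2) / 10)] with ε ⟨h0, hε⟩ ⟨_, hε'⟩
  have hsweep : ∀ S, IsShortestSchedule c (sweepRequests 1 1 (-1) (-1 + ε) ε).toFinset 0 S →
      IsLeftRightSweep 1 1 S := fun S hS =>
    hS.isLeftRightSweep hc h0 one_pos le_rfl (by linarith) (by linarith)
  obtain ⟨b, hb⟩ : ∃ b, b = α * opt c (sweepRequests 1 1 (-1) (-1 + ε) ε).toFinset := ⟨_, rfl⟩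
  have hαb : 3 * α ≤ b := by
    have := le_opt_sweepRequests hc hsweep
    nlinarith
  have hbα : b ≤ 3 * α + 5 * ε := by
    have := opt_sweepRequests_le hc h0 zero_le_one le_rfl (by linarith : -1 ≤ -1 + ε) (by linarith)
    nlinarith
  have hopt := opt_sweepRequests_append_le_three_mul hc h0 h1 (by linarith) hbα
  refine ⟨_, isRequestSequence_sweepRequests_append h0 (by linarith), by simp, hopt,
    (completesAfter_init_sweepRequests_append hc (by linarith) h0 zero_le_one
      (by linarith) (by linarith) hsweep hb ?_).mono ?_⟩
  · nlinarith
  · rw [sub_self, abs_zero, abs_of_neg (by linarith)]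
    linarith

theorem exists_isLeftRightSweep_and_opt_le (hc : 1 ≤ c) (h0 : 0 < ε) (huv : u ≤ v)
    (hvu : v < 3 * u) (hεu : ε < u) : ∃ p,
    -v ≤ p ∧ p ≤ -u ∧
    (∀ S, IsShortestSchedule c (sweepRequests u v p (-u + ε) ε).toFinset 0 S →
      IsLeftRightSweep u v S) ∧
    ∀ b, 2 * ε < b → b ≤ 2 * u + v + 3 * ε →
      opt c (sweepRequests u v p (-u + ε) ε ++ [(⟨-v, -u, b + ε⟩ : Request)]).toFinset ≤
        2 * v + u + 5 * ε := by
  have hu : 0 < u := h0.trans hεu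
  rcases hc.eq_or_lt with rfl | hc'
  · refine ⟨-u, by linarith, le_rfl, fun S hS => ?_, fun b hb hbv => ?_⟩
    · exact hS.isLeftRightSweep_one h0 huv hvu (by linarith) (by linarith)
    · exact opt_sweepRequests_append_le_one h0 hu.le huv hb hbv
  · have hc₂ : 2 ≤ c := one_add_one_eq_two (R := ℕ∞) ▸ Order.add_one_le_of_lt hc'
    refine ⟨-v, le_rfl, by linarith, fun S hS => ?_, fun b hb hbv => ?_⟩
    · exact hS.isLeftRightSweep hc h0 hu huv (by linarith) (by linarith)
    · exact opt_sweepRequests_append_le_of_two_le hc₂ h0 hu.le huv hb hbv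

theorem seven_add_div_three_le_competitiveRatio (hc : 1 ≤ c) (h1 : 5 / 7 < α) (h2 : α ≤ 1) :
    ENNReal.ofReal ((7 + α) / 3) ≤ competitiveRatio α B := by
  refine (ENNReal.ofReal_le_ofReal ?_).trans
    (le_competitiveRatio (X := fun _ => 7 + α) (T := fun ε => 3 + 5 * ε)
    (by fun_prop) (by fun_prop) (by norm_num) ?_)
  · norm_num
  filter_upwards [eventually_pos_lt (by norm_num : (0 : ℝ) < 1 / 10)] with ε ⟨h0, hε⟩
  -- `u` and `v` solve `2 * v + u = 3` and `2 * u + v = 3 * α`: going right first, the optimum is in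
  -- `-v` when the last request appears there.
  obtain ⟨p, hvp, hpu, hsweep, hopt⟩ := exists_isLeftRightSweep_and_opt_le (u := 2 * α - 1)
    (v := 2 - α) hc h0 (by linarith) (by linarith) (by linarith)
  obtain ⟨b, hb⟩ : ∃ b, b = α * opt c
    (sweepRequests (2 * α - 1) (2 - α) p (-(2 * α - 1) + ε) ε).toFinset := ⟨_, rfl⟩
  have hαb : 3 * α ≤ b := by nlinarith [le_opt_sweepRequests hc hsweep]
  have hbα : b ≤ 3 * α + 3 * ε := by
    have := opt_sweepRequests_le hc h0 (by linarith : 0 ≤ 2 * α - 1) hvp (by linarith)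
      (by linarith : -(2 * α - 1) + ε ≤ 0)
    nlinarith
  have hopt' := hopt b (by linarith) (by linarith)
  refine ⟨_, isRequestSequence_sweepRequests_append h0 (by linarith), by simp,
    hopt'.trans (by linarith),
    (completesAfter_init_sweepRequests_append hc (by linarith) h0 (by linarith)
      (by nlinarith) (by linarith) hsweep hb ?_).mono ?_⟩
  · nlinarith
  · rw [abs_of_neg (by linarith), abs_of_nonneg (by linarith)]
    linarith

end DialARide

theorem corollary2 (c : ℕ∞) (hc : 1 ≤ c) (α : ℝ) (hα : 0 ≤ α)
    (hα' : α ∉ Set.Ioo (2 * Real.goldenRatio / 3) Real.goldenRatio)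
    (B : DialARide.TieBreaking c) :
    ENNReal.ofReal (1 + Real.goldenRatio) ≤ DialARide.competitiveRatio α B := by
  have hsq := Real.goldenRatio_sq
  have hlb : 8 / 5 < Real.goldenRatio := by nlinarith [Real.one_lt_goldenRatio]
  have hub : Real.goldenRatio < 81 / 50 := by nlinarith
  rcases hα.eq_or_lt with rfl | h0
  · exact (ENNReal.ofReal_le_ofReal (by linarith)).trans
      (DialARide.three_le_competitiveRatio_zero hc B)
  obtain hφ | hφ : Real.goldenRatio ≤ α ∨ α ≤ 2 * Real.goldenRatio / 3 := by
    by_contra! h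
    exact hα' h.symm
  · exact (ENNReal.ofReal_le_ofReal (by linarith)).trans
      (DialARide.one_add_le_competitiveRatio hc h0)
  rcases le_total α (3 * Real.goldenRatio - 4) with h1 | h1
  · refine (ENNReal.ofReal_le_ofReal ?_).trans
      (DialARide.one_add_three_div_le_competitiveRatio hc h0 (by linarith))
    rw [add_le_add_iff_left, le_div_iff₀ (by linarith)]
    nlinarith
  rcases le_total α 1 with h2 | h2
  · exact (ENNReal.ofReal_le_ofReal (by linarith)).trans
      (DialARide.seven_add_div_three_le_competitiveRatio hc (by linarith) h2)
  · refine (ENNReal.ofReal_le_ofReal ?_).trans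
      (DialARide.two_add_div_le_competitiveRatio hc h2 (by nlinarith))
    rw [← sub_le_iff_le_add', le_div_iff₀ (by linarith)]
    nlinarith
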